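/- A convex polygon is the convex hull of finitely many points in the plane with nonempty interior. For $h\in\mathbb{N}$, let $\mathcal{C}(h)$ be the family of all sets $P=P_0\setminus\bigcup_{i=1}^h \operatorname{int}P_i$, where $P_0$ is a convex polygon and $P_1,\dots,P_h$ are pairwise disjoint convex polygons contained in the interior of $P_0$. For $P\in\mathcal{C}(h)$ and $s,t\in P$, let $\mathrm{geod}(s,t)$ be the infimum of the lengths of the polygonal paths from $s$ to $t$ contained in $P$, let $\mathrm{diam}_g(P)=\sup_{s,t\in P}\mathrm{geod}(s,t)$ and $\mathrm{diam}_2(P)=\sup_{s,t\in P}|st|$, and let $$g(h)=\sup_{P\in\mathcal{C}(h)}\frac{\mathrm{diam}_g(P)}{\mathrm{diam}_2(P)}.$$ Then there are absolute constants $c,C>0$ such that $c\,h^{1/3}\le g(h)\le C\,h^{1/2}$ for every integer $h\ge 1$. -/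

import Mathlib

open scoped ENNReal

/-- The Euclidean plane. -/
abbrev Plane : Type := EuclideanSpace ℝ (Fin 2)

/-- A (closed, nondegenerate) convex polygon: the convex hull of finitely many points,
with nonempty interior. -/
def IsConvexPolygon (S : Set Plane) : Prop :=
  (∃ V : Finset Plane, S = convexHull ℝ (V : Set Plane)) ∧ (interior S).Nonempty

/-- The family `𝒞(h)` of convex polygons with `h` convex holes: the outer polygon `P₀` and the
holes `Q i` are convex polygons, the holes are pairwise disjoint and lie in the interior of `P₀`.
The domain is closed: the open holes are removed, so paths may run along hole boundaries. -/
def convexDomains (h : ℕ) : Set (Set Plane) :=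
  {P | ∃ (P₀ : Set Plane) (Q : Fin h → Set Plane),
    IsConvexPolygon P₀ ∧ (∀ i, IsConvexPolygon (Q i)) ∧ (∀ i, Q i ⊆ interior P₀) ∧
    (∀ i j, i ≠ j → Disjoint (Q i) (Q j)) ∧ P = P₀ \ ⋃ i, interior (Q i)}

/-- The vertices `p 0, …, p n` form a polygonal path from `s` to `t` contained in `P`. -/
def IsPolygonalPath (P : Set Plane) (s t : Plane) (n : ℕ) (p : ℕ → Plane) : Prop :=
  p 0 = s ∧ p n = t ∧ s ∈ P ∧ ∀ i < n, segment ℝ (p i) (p (i + 1)) ⊆ P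

/-- The length of the polygonal path with vertices `p 0, …, p n`. -/
noncomputable def pathLength (n : ℕ) (p : ℕ → Plane) : ℝ≥0∞ :=
  ∑ i ∈ Finset.range n, edist (p i) (p (i + 1))

/-- The geodesic distance of `s` and `t` in `P`: the infimum of the lengths of the polygonal
paths from `s` to `t` in `P` (so `∞` if there is none). -/
noncomputable def geod (P : Set Plane) (s t : Plane) : ℝ≥0∞ :=
  ⨅ (n : ℕ) (p : ℕ → Plane) (_ : IsPolygonalPath P s t n p), pathLength n p

/-- The Euclidean diameter. -/
noncomputable def euclideanDiam (P : Set Plane) : ℝ≥0∞ :=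
  ⨆ s ∈ P, ⨆ t ∈ P, edist s t

/-- The geodesic diameter. -/
noncomputable def geodesicDiam (P : Set Plane) : ℝ≥0∞ :=
  ⨆ s ∈ P, ⨆ t ∈ P, geod P s t

/-- The distortion `ϱ(P)`. For `P` in `convexDomains h` the denominator is positive and finite. -/
noncomputable def distortion (P : Set Plane) : ℝ≥0∞ :=
  geodesicDiam P / euclideanDiam P

/-- `g(h)`, the supremum of the distortion over `𝒞(h)`. -/
noncomputable def maxDistortion (h : ℕ) : ℝ≥0∞ :=
  ⨆ P ∈ convexDomains h, distortion P

/-! Upper bound. Fix a slope `m` and measure height above lines of slope `m`. From a free point go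
straight up; on hitting a hole from below, slide along its lower chain to whichever end can be
reached without losing height, then go up again. On the parts of a chain whose slope differs from
`m` by at least `δ`, length is at most a multiple of `1/δ` times the height gained. The flat part of
a chain is charged to its hole; since height strictly increases from one chain end to the next, each
end is charged at most once (`IsHoled.step`, `IsHoled.reach_top`). Splitting the slopes in [0, 1]
into `N` windows, the flat parts of one hole have total width at most the diameter `D`, so in some
window the flat parts of all holes add up to at most `h D / N` (`IsHoled.exists_slope`). The path to
the top of the outer polygon thus has length O(N D + h D / N), which is O(√h D) for `N` about √h;
the outer boundary then leads to a common highest point.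

Lower bound. Nest k² regular k-gons, each turned by π/k against the previous one and enlarged by a
factor 1 + 10/k², so that all sizes stay bounded by an absolute constant. Shorten every side
slightly and use the k³ sides, thickened, as holes. A path from the centre outwards can cross a
polygon only near a corner, and corners of consecutive polygons are at least 2/k apart, so each
layer costs at least 1/k (`ofReal_le_geod_of_layers`). The total is of order k² · 1/k = k, with k
about the cube root of h. -/

/-! ### Polygonal paths and the geodesic distance -/

theorem IsPolygonalPath.mem {P : Set Plane} {s t : Plane} {n : ℕ} {p : ℕ → Plane}
    (h : IsPolygonalPath P s t n p) {i : ℕ} (hi : i ≤ n) : p i ∈ P := by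
  obtain ⟨h0, -, hs, hseg⟩ := h
  rcases i with _ | i
  · rwa [h0]
  · exact hseg i (by omega) (right_mem_segment ℝ _ _)

theorem IsPolygonalPath.tail {P : Set Plane} {s t : Plane} {n : ℕ} {p : ℕ → Plane}
    (h : IsPolygonalPath P s t (n + 1) p) :
    IsPolygonalPath P (p 1) t n (fun i => p (i + 1)) :=
  ⟨rfl, h.2.1, h.mem (by omega), fun i hi => h.2.2.2 (i + 1) (by omega)⟩

theorem pathLength_succ (n : ℕ) (p : ℕ → Plane) :
    pathLength (n + 1) p = edist (p 0) (p 1) + pathLength n (fun i => p (i + 1)) := by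
  simp only [pathLength]
  rw [Finset.sum_range_succ', add_comm]

theorem edist_le_pathLength (n : ℕ) (p : ℕ → Plane) : edist (p 0) (p n) ≤ pathLength n p := by
  simpa [pathLength] using edist_le_range_sum_edist p n

theorem geod_le_pathLength {P : Set Plane} {s t : Plane} {n : ℕ} {p : ℕ → Plane}
    (h : IsPolygonalPath P s t n p) : geod P s t ≤ pathLength n p :=
  iInf_le_of_le n (iInf_le_of_le p (iInf_le_of_le h le_rfl))

theorem edist_le_geod (P : Set Plane) (s t : Plane) : edist s t ≤ geod P s t := by
  refine le_iInf fun n => le_iInf fun p => le_iInf fun h => ?_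
  rw [← h.1, ← h.2.1]
  exact edist_le_pathLength n p

theorem geod_le_edist {P : Set Plane} {s t : Plane} (h : segment ℝ s t ⊆ P) :
    geod P s t ≤ edist s t := by
  have : IsPolygonalPath P s t 1 (fun i => if i = 0 then s else t) :=
    ⟨by simp, by simp, h (left_mem_segment ℝ s t), fun i hi => by
      obtain rfl : i = 0 := by omega
      simpa using h⟩
  simpa [pathLength] using geod_le_pathLength this

theorem geod_self {P : Set Plane} {s : Plane} (h : s ∈ P) : geod P s s = 0 := by
  have := geod_le_edist (P := P) (s := s) (t := s) (by simpa using h)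
  simpa using this

theorem geod_le_edist_add {P : Set Plane} {s z t : Plane} {n : ℕ} {p : ℕ → Plane}
    (h : IsPolygonalPath P z t n p) (hs : segment ℝ s z ⊆ P) :
    geod P s t ≤ edist s z + pathLength n p := by
  have : IsPolygonalPath P s t (n + 1) (fun i => if i = 0 then s else p (i - 1)) := by
    refine ⟨by simp, by simpa using h.2.1, hs (left_mem_segment ℝ s z), fun i hi => ?_⟩
    rcases i with _ | i
    · simpa [h.1] using hs
    · simpa using h.2.2.2 i (by omega)
  refine (geod_le_pathLength this).trans ?_
  rw [pathLength_succ]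
  simp [h.1]

theorem geod_le_edist_add_geod {P : Set Plane} {s z t : Plane} (hs : segment ℝ s z ⊆ P) :
    geod P s t ≤ edist s z + geod P z t := by
  conv_rhs => unfold geod
  simp only [ENNReal.add_iInf]
  exact le_iInf fun n => le_iInf fun p => le_iInf fun h => geod_le_edist_add h hs

theorem geod_le_pathLength_add_geod {P : Set Plane} {s z t : Plane} {n : ℕ} {p : ℕ → Plane}
    (h : IsPolygonalPath P s z n p) : geod P s t ≤ pathLength n p + geod P z t := by
  induction n generalizing s p with
  | zero =>
    have : s = z := h.1.symm.trans h.2.1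
    simp [this]
  | succ n ih =>
    rw [pathLength_succ, add_assoc, h.1]
    refine (geod_le_edist_add_geod (z := p 1) ?_).trans (by gcongr; exact ih h.tail)
    simpa [h.1] using h.2.2.2 0 (by omega)

theorem geod_triangle (P : Set Plane) (s z t : Plane) :
    geod P s t ≤ geod P s z + geod P z t := by
  conv_rhs => enter [1]; unfold geod
  simp only [ENNReal.iInf_add]
  exact le_iInf fun n => le_iInf fun p => le_iInf fun h => geod_le_pathLength_add_geod h

theorem geod_le_geod_swap (P : Set Plane) (s t : Plane) : geod P s t ≤ geod P t s := by
  refine le_iInf fun n => le_iInf fun p => le_iInf fun h => ?_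
  induction n generalizing t p with
  | zero =>
    have : t = s := h.1.symm.trans h.2.1
    subst this
    simp [geod_self h.2.2.1]
  | succ n ih =>
    have hseg : segment ℝ (p 1) t ⊆ P := by
      rw [segment_symm]; simpa [h.1] using h.2.2.2 0 (by omega)
    rw [pathLength_succ, h.1, add_comm, edist_comm]
    exact (geod_triangle P s (p 1) t).trans (add_le_add (ih _ _ h.tail) (geod_le_edist hseg))

theorem geod_comm (P : Set Plane) (s t : Plane) : geod P s t = geod P t s :=
  le_antisymm (geod_le_geod_swap P s t) (geod_le_geod_swap P t s)

theorem geod_anti {P P' : Set Plane} (h : P ⊆ P') (s t : Plane) : geod P' s t ≤ geod P s t :=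
  le_iInf fun _ => le_iInf fun _ => le_iInf fun hp =>
    geod_le_pathLength ⟨hp.1, hp.2.1, h hp.2.2.1, fun i hi => (hp.2.2.2 i hi).trans h⟩

theorem geod_le_ofReal_add {P : Set Plane} {s z t : Plane} {a b : ℝ} (ha : 0 ≤ a) (hb : 0 ≤ b)
    (h₁ : geod P s z ≤ ENNReal.ofReal a) (h₂ : geod P z t ≤ ENNReal.ofReal b) :
    geod P s t ≤ ENNReal.ofReal (a + b) := by
  rw [ENNReal.ofReal_add ha hb]
  exact (geod_triangle P s z t).trans (add_le_add h₁ h₂)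

theorem edist_add_edist_of_mem_segment {x y z : Plane} (h : z ∈ segment ℝ x y) :
    edist x z + edist z y = edist x y := by
  rw [edist_dist, edist_dist, edist_dist, ← ENNReal.ofReal_add dist_nonneg dist_nonneg,
    dist_add_dist_of_mem_segment h]

/-- A path along which a continuous function passes the level `c` has a point on that level. -/
theorem exists_level_le_pathLength {P : Set Plane} {s t : Plane} {n : ℕ} {p : ℕ → Plane}
    (h : IsPolygonalPath P s t n p) {f : Plane → ℝ} (hf : Continuous f) {c : ℝ}
    (hs : f s ≤ c) (ht : c ≤ f t) :
    ∃ z ∈ P, f z = c ∧ edist s z + geod P z t ≤ pathLength n p := by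
  induction n generalizing s p with
  | zero =>
    have : s = t := h.1.symm.trans h.2.1
    subst this
    exact ⟨s, h.2.2.1, le_antisymm hs ht, by simp [geod_self h.2.2.1]⟩
  | succ n ih =>
    have hseg : segment ℝ s (p 1) ⊆ P := by simpa [h.1] using h.2.2.2 0 (by omega)
    rw [pathLength_succ, h.1]
    rcases le_total (f (p 1)) c with h1 | h1
    · obtain ⟨z, hz, hfz, hl⟩ := ih h.tail h1
      refine ⟨z, hz, hfz, ?_⟩
      calc edist s z + geod P z t ≤ edist s (p 1) + edist (p 1) z + geod P z t := by
            gcongr; exact edist_triangle _ _ _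
        _ ≤ _ := by rw [add_assoc]; gcongr
    · obtain ⟨z, hz, hfz⟩ := (convex_segment s (p 1)).isPreconnected.intermediate_value
        (left_mem_segment ℝ s (p 1)) (right_mem_segment ℝ s (p 1)) hf.continuousOn ⟨hs, h1⟩
      refine ⟨z, hseg hz, hfz, ?_⟩
      rw [← edist_add_edist_of_mem_segment hz, add_assoc]
      gcongr
      refine geod_le_edist_add h.tail (subset_trans ?_ hseg)
      exact (convex_segment s (p 1)).segment_subset hz (right_mem_segment ℝ s (p 1))

/-! ### Lower chains of convex polygons -/

/-- `q` is a point of `K` at which `Y` is least among the points of `K` with the same `X`. -/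
def IsLowest (X Y : Plane →ₗ[ℝ] ℝ) (K : Set Plane) (q : Plane) : Prop :=
  q ∈ K ∧ ∀ w ∈ K, X w = X q → Y q ≤ Y w

/-- The point of the chord from `a` to `b` over `X q` lies in `K`, so it is not below `q`.
Denominators are cleared. -/
theorem IsLowest.le_chord {X Y : Plane →ₗ[ℝ] ℝ} {K : Set Plane} {q a b : Plane}
    (hq : IsLowest X Y K q) (hK : Convex ℝ K) (ha : a ∈ K) (hb : b ∈ K)
    (haq : X a ≤ X q) (hqb : X q ≤ X b) (hab : X a < X b) :
    (X b - X a) * Y q ≤ (X b - X q) * Y a + (X q - X a) * Y b := by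
  have hd : 0 < X b - X a := by linarith
  have hmem : ((X b - X q) / (X b - X a)) • a + ((X q - X a) / (X b - X a)) • b ∈ K :=
    hK ha hb (div_nonneg (by linarith) hd.le) (div_nonneg (by linarith) hd.le)
      (by field_simp; ring)
  have := hq.2 _ hmem (by
    simp only [map_add, map_smul, smul_eq_mul]; field_simp; ring)
  simp only [map_add, map_smul, smul_eq_mul] at this
  have h2 := mul_le_mul_of_nonneg_left this hd.le
  calc _ ≤ _ := h2
    _ = _ := by field_simp

theorem le_of_mem_convexHull {f : Plane →ₗ[ℝ] ℝ} {V : Set Plane} {c : ℝ}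
    (h : ∀ v ∈ V, c ≤ f v) : ∀ w ∈ convexHull ℝ V, c ≤ f w := fun _ hw =>
  convexHull_min (t := {w | c ≤ f w}) h (convex_halfSpace_ge f.isLinear c) hw

/-- The line through `q` and `v` supports the hull as soon as it supports the vertices to the right
of `q`: a vertex below the line on the other side would span with `v` a chord passing below `q`. -/
theorem IsLowest.support {X Y : Plane →ₗ[ℝ] ℝ} {V : Set Plane} {q v : Plane} {σ : ℝ}
    (hq : IsLowest X Y (convexHull ℝ V) q) (hv : v ∈ convexHull ℝ V) (hqv : X q < X v)
    (hσ : Y v - Y q = σ * (X v - X q))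
    (h : ∀ w ∈ V, X q < X w → σ * (X w - X q) ≤ Y w - Y q) :
    ∀ w ∈ convexHull ℝ V, σ * (X w - X q) ≤ Y w - Y q := by
  have key : ∀ w ∈ V, Y q - σ * X q ≤ (Y - σ • X) w := by
    intro w hw
    simp only [LinearMap.sub_apply, LinearMap.smul_apply, smul_eq_mul]
    rcases lt_or_ge (X q) (X w) with h1 | h1
    · linarith [h w hw h1]
    · have hc := hq.le_chord (convex_convexHull ℝ V) (subset_convexHull ℝ V hw) hv h1 hqv.le
        (by linarith)
      have : 0 ≤ (X v - X q) * (Y w - Y q - σ * (X w - X q)) := by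
        have hYv : Y v = Y q + σ * (X v - X q) := by linarith
        rw [hYv] at hc
        nlinarith
      have := nonneg_of_mul_nonneg_right this (by linarith)
      linarith
  intro w hw
  have := le_of_mem_convexHull key w hw
  simp only [LinearMap.sub_apply, LinearMap.smul_apply, smul_eq_mul] at this
  linarith

theorem notMem_interior_of_ray {K : Set Plane} {z d : Plane}
    (h : ∀ τ : ℝ, 0 < τ → z - τ • d ∉ K) : z ∉ interior K := by
  intro hz
  have hc : ContinuousAt (fun t : ℝ => z - t • d) 0 := by fun_prop
  have h1 : ∀ᶠ t : ℝ in nhds 0, z - t • d ∈ interior K :=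
    hc.eventually (isOpen_interior.mem_nhds (by simpa using hz))
  obtain ⟨ε, hε, hb⟩ := Metric.eventually_nhds_iff.1 h1
  exact h (ε / 2) (by linarith)
    (interior_subset (hb (y := ε / 2) (by simp [abs_of_pos hε]; linarith)))

theorem notMem_interior_of_isMin {f : Plane →ₗ[ℝ] ℝ} {K : Set Plane} {z d : Plane}
    (hd : 0 < f d) (h : ∀ w ∈ K, f z ≤ f w) : z ∉ interior K := by
  refine notMem_interior_of_ray (d := d) fun τ hτ hmem => ?_
  have h3 := h _ hmem
  simp only [map_sub, map_smul, smul_eq_mul] at h3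
  nlinarith

theorem IsLowest.notMem_interior {X Y : Plane →ₗ[ℝ] ℝ} {K : Set Plane} {q d : Plane}
    (hq : IsLowest X Y K q) (hXd : X d = 0) (hYd : Y d = 1) : q ∉ interior K := by
  refine notMem_interior_of_ray (d := d) fun τ hτ hmem => ?_
  have := hq.2 _ hmem (by simp [hXd])
  simp only [map_sub, map_smul, smul_eq_mul, hYd] at this
  linarith

theorem segment_subset_boundary {f : Plane →ₗ[ℝ] ℝ} {K : Set Plane} {q v d : Plane}
    (hK : Convex ℝ K) (hd : 0 < f d) (hq : q ∈ K) (hv : v ∈ K) (hqv : f q = f v)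
    (h : ∀ w ∈ K, f q ≤ f w) : segment ℝ q v ⊆ K \ interior K := by
  rintro z hz
  refine ⟨hK.segment_subset hq hv hz, notMem_interior_of_isMin hd ?_⟩
  obtain ⟨a, b, -, -, hab, rfl⟩ := hz
  intro w hw
  have : f (a • q + b • v) = f q := by
    simp only [map_add, map_smul, smul_eq_mul, ← hqv]
    rw [← add_mul, hab, one_mul]
  rw [this]; exact h w hw

/-- Two lowest points of a convex polygon are joined along the lower chain. -/
theorem geod_lower_chain {X Y : Plane →ₗ[ℝ] ℝ} {V : Finset Plane} {K : Set Plane}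
    (hKV : K = convexHull ℝ (V : Set Plane)) {d : Plane} (hXd : X d = 0) (hYd : Y d = 1) {A B : ℝ}
    (hA : 0 ≤ A) (hB : 0 ≤ B)
    (hdist : ∀ z w, dist z w ≤ A * |X z - X w| + B * |Y z - Y w|) {q e : Plane}
    (hq : IsLowest X Y K q) (he : IsLowest X Y K e)
    (hqe : X q ≤ X e) (hslope : ∀ w ∈ K, X q < X w → Y q ≤ Y w) :
    Y q ≤ Y e ∧ geod (K \ interior K) q e ≤
      ENNReal.ofReal (A * (X e - X q) + B * (Y e - Y q)) := by
  classical
  have hK : Convex ℝ K := hKV ▸ convex_convexHull ℝ _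
  -- Gift wrapping: follow the edge of least slope out of `q` and induct on the number of vertices
  -- further right. The length bound is additive because `X` and `Y` are both monotone along the
  -- chain.
  induction hn : (V.filter fun w => X q < X w).card using Nat.strong_induction_on
    generalizing q with
  | _ n ih =>
  rcases hqe.eq_or_lt with hqe' | hlt
  · have hY : Y q = Y e := le_antisymm (hq.2 e he.1 hqe'.symm) (he.2 q hq.1 hqe')
    have : q = e := by
      have := hdist q e
      rw [hY, hqe'] at this
      simpa using this
    subst this
    refine ⟨le_rfl, ?_⟩
    rw [geod_self (Set.mem_sdiff_of_mem hq.1 (hq.notMem_interior hXd hYd))]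
    simp
  · have hins : ∀ c ∈ insert e V, c ∈ K := by
      intro c hc
      rcases Finset.mem_insert.1 hc with rfl | hc
      · exact he.1
      · rw [hKV]; exact subset_convexHull ℝ _ (by simpa using hc)
    -- `e` need not be a vertex, so it is added as a candidate endpoint.
    obtain ⟨v, hv, hmin⟩ := ((insert e V).filter fun w => X q < X w).exists_min_image
      (fun w => (Y w - Y q) / (X w - X q)) ⟨e, by simp [hlt]⟩
    -- it suffices to treat a candidate `c` of least slope
    have main : ∀ c ∈ insert e V, X q < X c →
        (∀ w ∈ insert e V, X q < X w →
          (Y c - Y q) / (X c - X q) * (X w - X q) ≤ Y w - Y q) →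
        Y q ≤ Y c ∧ (∀ w ∈ K, (Y c - Y q) / (X c - X q) * (X w - X q) ≤ Y w - Y q) ∧
        geod (K \ interior K) q c ≤ ENNReal.ofReal (A * (X c - X q) + B * (Y c - Y q)) := by
      intro c hc hqc hcmin
      have hpos : 0 < X c - X q := by linarith
      have hσ : Y c - Y q = (Y c - Y q) / (X c - X q) * (X c - X q) := by field_simp
      have hsup : ∀ w ∈ K, (Y c - Y q) / (X c - X q) * (X w - X q) ≤ Y w - Y q := by
        rw [hKV]
        refine IsLowest.support (hKV ▸ hq) (hKV ▸ hins c hc) hqc hσ fun w hw h => ?_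
        exact hcmin w (Finset.mem_insert_of_mem hw) h
      have hY : Y q ≤ Y c := hslope c (hins c hc) hqc
      refine ⟨hY, hsup, ?_⟩
      refine (geod_le_edist (segment_subset_boundary
        (f := Y - ((Y c - Y q) / (X c - X q)) • X) (d := d) hK (by simp [hXd, hYd])
        hq.1 (hins c hc) ?_ ?_)).trans ?_
      · simp only [LinearMap.sub_apply, LinearMap.smul_apply, smul_eq_mul]
        linarith
      · intro w hw
        have := hsup w hw
        simp only [LinearMap.sub_apply, LinearMap.smul_apply, smul_eq_mul]
        linarith
      · rw [edist_dist]
        refine ENNReal.ofReal_le_ofReal ((hdist q c).trans_eq ?_)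
        rw [abs_sub_comm, abs_of_pos hpos, abs_sub_comm, abs_of_nonneg (by linarith)]
    have hminimal : ∀ c ∈ insert e V, X q < X c →
        (Y c - Y q) / (X c - X q) ≤ (Y v - Y q) / (X v - X q) →
        ∀ w ∈ insert e V, X q < X w →
          (Y c - Y q) / (X c - X q) * (X w - X q) ≤ Y w - Y q := by
      intro c _ _ hcv w hw hqw
      rw [← le_div_iff₀ (by linarith)]
      exact hcv.trans (hmin w (by simp [hqw]; simpa using hw))
    obtain ⟨hv, hqv⟩ := Finset.mem_filter.1 hv
    rcases le_or_gt ((Y e - Y q) / (X e - X q)) ((Y v - Y q) / (X v - X q)) with hev | hve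
    · obtain ⟨h1, -, h2⟩ := main e (by simp) hlt (hminimal e (by simp) hlt hev)
      exact ⟨h1, h2⟩
    · obtain ⟨h1, hsup, h2⟩ := main v hv hqv (hminimal v hv hqv le_rfl)
      have hσ : Y v - Y q = (Y v - Y q) / (X v - X q) * (X v - X q) := by
        field_simp [(sub_pos.2 hqv).ne']
      have hσ0 : 0 ≤ (Y v - Y q) / (X v - X q) := div_nonneg (by linarith) (by linarith)
      set σ := (Y v - Y q) / (X v - X q)
      rw [lt_div_iff₀ (by linarith)] at hve
      -- Otherwise the chord from `q` to `v` passes over `X e`, and `e`, being lowest, would have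
      -- slope at most `σ`.
      have hve' : X v < X e := by
        by_contra! hge
        have := he.le_chord hK hq.1 (hins v hv) hqe hge hqv
        rw [show Y v = Y q + σ * (X v - X q) by linarith] at this
        nlinarith
      have hvV : v ∈ V := by
        rcases Finset.mem_insert.1 hv with rfl | h
        · exact absurd hve' (lt_irrefl _)
        · exact h
      have hvlow : IsLowest X Y K v := ⟨hins v hv, fun w hw hwv => by
        have := hsup w hw
        rw [hwv] at this
        linarith⟩
      have hcard : (V.filter fun w => X v < X w).card < n := by
        rw [← hn]
        refine Finset.card_lt_card ?_
        refine ⟨fun w hw => ?_, fun h => ?_⟩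
        · simp only [Finset.mem_filter] at hw ⊢
          exact ⟨hw.1, hqv.trans hw.2⟩
        · have := @h v (by simp [hvV, hqv])
          simp at this
      obtain ⟨h3, h4⟩ := ih _ hcard hvlow hve'.le (fun w hw hvw => by
        have := hsup w hw
        nlinarith) rfl
      refine ⟨h1.trans h3, ?_⟩
      convert geod_le_ofReal_add ?_ ?_ h2 h4 using 2
      · ring
      · exact add_nonneg (mul_nonneg hA (by linarith)) (mul_nonneg hB (by linarith))
      · exact add_nonneg (mul_nonneg hA (by linarith)) (mul_nonneg hB (by linarith))

theorem IsLowest.neg {X Y : Plane →ₗ[ℝ] ℝ} {K : Set Plane} {q : Plane}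
    (hq : IsLowest X Y K q) : IsLowest (-X) Y K q :=
  ⟨hq.1, fun w hw h => hq.2 w hw (by simpa using h)⟩

/-- Sliding along the lower chain from `q` to the end `e`, with `Y` nondecreasing. The part of
slope less than `δ` lies between the points minimizing `Y + δ X` and `Y - δ X`. -/
theorem geod_slide {X Y : Plane →ₗ[ℝ] ℝ} {V : Finset Plane} {K : Set Plane}
    (hKV : K = convexHull ℝ (V : Set Plane)) {d : Plane} (hXd : X d = 0) (hYd : Y d = 1) {A B : ℝ}
    (hA : 0 ≤ A) (hB : 0 ≤ B)
    (hdist : ∀ z w, dist z w ≤ A * |X z - X w| + B * |Y z - Y w|) {q e a b : Plane} {δ : ℝ}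
    (hδ : 0 < δ) (hq : IsLowest X Y K q) (he : IsLowest X Y K e)
    (hmax : ∀ w ∈ K, X w ≤ X e) (hslope : ∀ w ∈ K, X q < X w → Y q ≤ Y w)
    (haK : a ∈ K) (hbK : b ∈ K) (ha : ∀ w ∈ K, Y a + δ * X a ≤ Y w + δ * X w)
    (hb : ∀ w ∈ K, Y b - δ * X b ≤ Y w - δ * X w) :
    Y q ≤ Y e ∧ geod (K \ interior K) q e ≤
      ENNReal.ofReal (A * (X b - X a) + (A / δ + B) * (Y e - Y q)) := by
  have hK : Convex ℝ K := hKV ▸ convex_convexHull ℝ _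
  obtain ⟨h1, h2⟩ := geod_lower_chain hKV hXd hYd hA hB hdist hq he (hmax q hq.1) hslope
  refine ⟨h1, h2.trans (ENNReal.ofReal_le_ofReal ?_)⟩
  have haq : X a ≤ X q := by
    by_contra! h
    nlinarith [hslope a haK h, ha q hq.1]
  have hab : X a ≤ X b := by nlinarith [ha b hbK, hb a haK]
  -- The horizontal run is at most the flat width plus rise divided by `δ`. If `q` is left of `b`,
  -- only the run beyond `b` is paid for by the rise; otherwise, by convexity, the whole chain from
  -- `q` has slope at least `δ`.
  suffices δ * (X e - X q) ≤ δ * (X b - X a) + (Y e - Y q) by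
    have h3 : X e - X q ≤ (X b - X a) + (Y e - Y q) / δ := by
      rw [← sub_le_iff_le_add', le_div_iff₀ hδ]; linarith
    have := mul_le_mul_of_nonneg_left h3 hA
    calc _ ≤ A * (X b - X a + (Y e - Y q) / δ) + B * (Y e - Y q) := by linarith
      _ = _ := by ring
  rcases lt_or_ge (X q) (X b) with h | h
  · nlinarith [hslope b hbK h, hb e he.1]
  · rcases (hmax b hbK).eq_or_lt with h' | h'
    · nlinarith [hmax q hq.1]
    · have hc := hq.le_chord hK hbK he.1 h (hmax q hq.1) h'
      have hbe := hb e he.1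
      have h4 : 0 ≤ (X e - X b) * ((Y e - Y q) - δ * (X e - X q)) := by
        nlinarith [mul_nonneg (sub_nonneg.2 (hmax q hq.1)) (sub_nonneg.2 hbe)]
      have := nonneg_of_mul_nonneg_right h4 (by linarith)
      nlinarith

/-- From a lowest point one can move without descending either to the right or to the left. -/
theorem IsLowest.slope_nonneg_or {X Y : Plane →ₗ[ℝ] ℝ} {K : Set Plane} {q : Plane}
    (hq : IsLowest X Y K q) (hK : Convex ℝ K) :
    (∀ w ∈ K, X q < X w → Y q ≤ Y w) ∨ (∀ w ∈ K, X w < X q → Y q ≤ Y w) := by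
  by_contra! h
  obtain ⟨⟨b, hb, hqb, hYb⟩, a, ha, haq, hYa⟩ := h
  nlinarith [hq.le_chord hK ha hb haq.le hqb.le (by linarith)]

/-- The points of greatest `X` may form a vertical edge; its lowest point is the end of the lower
chain. -/
theorem exists_isLowest_max {K : Set Plane} (hK : IsCompact K) (hne : K.Nonempty)
    (X Y : Plane →ₗ[ℝ] ℝ) : ∃ e, IsLowest X Y K e ∧ ∀ w ∈ K, X w ≤ X e := by
  have hX : Continuous X := X.continuous_of_finiteDimensional
  have hY : Continuous Y := Y.continuous_of_finiteDimensional
  obtain ⟨u, hu, humax⟩ := hK.exists_isMaxOn hne hX.continuousOn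
  obtain ⟨e, ⟨he, heu⟩, hemin⟩ := (hK.inter_right (isClosed_eq hX continuous_const :
    IsClosed {w | X w = X u})).exists_isMinOn ⟨u, hu, rfl⟩ hY.continuousOn
  refine ⟨e, ⟨he, fun w hw hwe => hemin ⟨hw, hwe.trans heu⟩⟩, fun w hw => ?_⟩
  rw [show X e = X u from heu]
  exact humax hw

/-! ### Free space and rays -/

/-- The outer region without the interiors of the holes. -/
def freeSpace {h : ℕ} (K : Set Plane) (Q : Fin h → Set Plane) : Set Plane :=
  K \ ⋃ i, interior (Q i)

/-- Keeps the outer polygon and the holes, which a bare member of `convexDomains h` forgets. -/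
structure IsHoled {h : ℕ} (K : Set Plane) (Q : Fin h → Set Plane) : Prop where
  outer : IsConvexPolygon K
  hole : ∀ i, IsConvexPolygon (Q i)
  sub : ∀ i, Q i ⊆ interior K
  disj : ∀ i j, i ≠ j → Disjoint (Q i) (Q j)

theorem IsConvexPolygon.convex {K : Set Plane} (h : IsConvexPolygon K) : Convex ℝ K := by
  obtain ⟨⟨V, rfl⟩, -⟩ := h; exact convex_convexHull ℝ _

theorem IsConvexPolygon.isCompact {K : Set Plane} (h : IsConvexPolygon K) : IsCompact K := by
  obtain ⟨⟨V, rfl⟩, -⟩ := h; exact V.finite_toSet.isCompact_convexHull ℝ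

theorem IsConvexPolygon.nonempty {K : Set Plane} (h : IsConvexPolygon K) : K.Nonempty :=
  h.2.mono interior_subset

/-- Sliding along a hole is legal because the closed holes, not only their interiors, are disjoint.
-/
theorem IsHoled.boundary_subset {h : ℕ} {K : Set Plane} {Q : Fin h → Set Plane}
    (H : IsHoled K Q) (i : Fin h) : Q i \ interior (Q i) ⊆ freeSpace K Q := by
  rintro z ⟨hz, hzi⟩
  refine ⟨interior_subset (H.sub i hz), ?_⟩
  simp only [Set.mem_iUnion, not_exists]
  intro j hj
  rcases eq_or_ne i j with rfl | hij
  · exact hzi hj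
  · exact Set.disjoint_left.1 (H.disj i j hij) hz (interior_subset hj)

theorem IsHoled.outer_boundary_subset {h : ℕ} {K : Set Plane} {Q : Fin h → Set Plane}
    (H : IsHoled K Q) : K \ interior K ⊆ freeSpace K Q := by
  rintro z ⟨hz, hzi⟩
  refine ⟨hz, ?_⟩
  simp only [Set.mem_iUnion, not_exists]
  exact fun j hj => hzi (H.sub j (interior_subset hj))

theorem exists_of_mem_segment_ray {p d z : Plane} {T : ℝ} (hT : 0 ≤ T)
    (hz : z ∈ segment ℝ p (p + T • d)) : ∃ t, 0 ≤ t ∧ t ≤ T ∧ z = p + t • d := by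
  obtain ⟨a, b, ha, hb, hab, rfl⟩ := hz
  refine ⟨b * T, by positivity, by nlinarith, ?_⟩
  rw [smul_add, ← add_assoc, ← add_smul, hab, one_smul, smul_smul]

/-- A ray from a free point either reaches the outer boundary or hits a first hole. -/
theorem IsHoled.ray {h : ℕ} {K : Set Plane} {Q : Fin h → Set Plane}
    (H : IsHoled K Q) {p d : Plane} (hp : p ∈ freeSpace K Q) (hd : d ≠ 0) :
    (∃ T : ℝ, 0 ≤ T ∧ p + T • d ∈ K ∧ (∀ τ : ℝ, 0 < τ → p + T • d + τ • d ∉ K) ∧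
      segment ℝ p (p + T • d) ⊆ freeSpace K Q) ∨
    (∃ i, ∃ T T' : ℝ, 0 ≤ T ∧ T < T' ∧ p + T • d ∈ Q i ∧ p + T' • d ∈ interior (Q i) ∧
      segment ℝ p (p + T • d) ⊆ freeSpace K Q) := by
  classical
  have hcont : Continuous fun t : ℝ => p + t • d := by fun_prop
  by_cases hhit : ∃ i, ∃ t : ℝ, 0 ≤ t ∧ p + t • d ∈ interior (Q i)
  · right
    -- `T i` is the first time in the closed hole, but only for holes whose interior is met; holes
    -- merely grazed do not stop the ray. The others get the dummy value 0 and are filtered out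
    -- below.
    have hmin : ∀ i, ∃ T : ℝ, (∃ t : ℝ, 0 ≤ t ∧ p + t • d ∈ interior (Q i)) →
        0 ≤ T ∧ p + T • d ∈ Q i ∧ ∀ t : ℝ, 0 ≤ t → p + t • d ∈ Q i → T ≤ t := by
      intro i
      by_cases hi : ∃ t : ℝ, 0 ≤ t ∧ p + t • d ∈ interior (Q i)
      · obtain ⟨t, ht, hti⟩ := hi
        have hcl : IsClosed {t : ℝ | 0 ≤ t ∧ p + t • d ∈ Q i} :=
          isClosed_Ici.inter ((H.hole i).isCompact.isClosed.preimage hcont)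
        have hbd : BddBelow {t : ℝ | 0 ≤ t ∧ p + t • d ∈ Q i} := ⟨0, fun t ht => ht.1⟩
        have hm := hcl.csInf_mem ⟨t, ht, interior_subset hti⟩ hbd
        exact ⟨_, fun _ => ⟨hm.1, hm.2, fun t h1 h2 => csInf_le hbd ⟨h1, h2⟩⟩⟩
      · exact ⟨0, fun h => absurd h hi⟩
    choose T hT using hmin
    obtain ⟨i, hi, hile⟩ := (Finset.univ.filter fun i =>
      ∃ t : ℝ, 0 ≤ t ∧ p + t • d ∈ interior (Q i)).exists_min_image T
      (by obtain ⟨i, hi⟩ := hhit; exact ⟨i, by simpa using hi⟩)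
    simp only [Finset.mem_filter, Finset.mem_univ, true_and] at hi hile
    obtain ⟨hT0, hTi, hTmin⟩ := hT i hi
    have hfree : ∀ t : ℝ, 0 ≤ t → t ≤ T i → p + t • d ∈ freeSpace K Q := by
      intro t ht htT
      refine ⟨H.outer.convex.segment_subset hp.1 (interior_subset (H.sub i hTi)) ?_, ?_⟩
      · rcases hT0.eq_or_lt with h0 | h0
        · have : t = 0 := by linarith
          subst this
          simpa using left_mem_segment ℝ p _
        · refine ⟨1 - t / T i, t / T i, ?_, by positivity, by ring, ?_⟩
          · rw [sub_nonneg, div_le_one h0]; exact htT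
          · rw [smul_add, ← add_assoc, ← add_smul, smul_smul]
            rw [div_mul_cancel₀ _ h0.ne', sub_add_cancel, one_smul]
      simp only [Set.mem_iUnion, not_exists]
      intro j hj
      have hTj := hile j ⟨t, ht, hj⟩
      have hjt := (hT j ⟨t, ht, hj⟩).2.2 t ht (interior_subset hj)
      have htT' : t = T i := by linarith
      subst htT'
      rcases eq_or_ne i j with rfl | hij
      · rcases hT0.eq_or_lt with h0 | h0
        · rw [← h0] at hj
          exact hp.2 (Set.mem_iUnion.2 ⟨i, by simpa using hj⟩)
        -- If the first contact were interior, openness would give an earlier one.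
        · have h1 : ∀ᶠ t : ℝ in nhds (T i), p + t • d ∈ interior (Q i) :=
            hcont.continuousAt.eventually (isOpen_interior.mem_nhds hj)
          obtain ⟨s, hs, hs0, hsT⟩ := ((h1.and (lt_mem_nhds h0)).filter_mono
            (nhdsWithin_le_nhds (s := Set.Iio (T i)))).and self_mem_nhdsWithin |>.exists.imp
              fun s hs => (⟨hs.1.1, hs.1.2, hs.2⟩ : _ ∧ _ ∧ s < T i)
          linarith [hTmin s hs0.le (interior_subset hs)]
      · exact Set.disjoint_left.1 (H.disj i j hij) hTi (interior_subset hj)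
    obtain ⟨t', ht', hti'⟩ := hi
    refine ⟨i, T i, t', hT0, lt_of_le_of_ne (hTmin t' ht' (interior_subset hti')) ?_, hTi, hti',
      ?_⟩
    · rintro rfl
      exact (hfree _ ht' le_rfl).2 (Set.mem_iUnion.2 ⟨i, hti'⟩)
    · intro z hz
      obtain ⟨t, h1, h2, rfl⟩ := exists_of_mem_segment_ray hT0 hz
      exact hfree t h1 h2
  · left
    push Not at hhit
    have hcl : IsClosed {t : ℝ | 0 ≤ t ∧ p + t • d ∈ K} :=
      isClosed_Ici.inter (H.outer.isCompact.isClosed.preimage hcont)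
    obtain ⟨R, hR⟩ := H.outer.isCompact.isBounded.subset_closedBall p
    have hbd : BddAbove {t : ℝ | 0 ≤ t ∧ p + t • d ∈ K} := by
      refine ⟨R / ‖d‖, fun t ht => ?_⟩
      have := hR ht.2
      rw [Metric.mem_closedBall, dist_self_add_left, norm_smul, Real.norm_of_nonneg ht.1] at this
      rwa [le_div_iff₀ (norm_pos_iff.2 hd)]
    have hm := hcl.csSup_mem ⟨0, le_rfl, by simpa using hp.1⟩ hbd
    set T := sSup {t : ℝ | 0 ≤ t ∧ p + t • d ∈ K}
    refine ⟨T, hm.1, hm.2, fun τ hτ hmem => ?_, fun z hz => ⟨?_, ?_⟩⟩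
    · have : T + τ ≤ T := le_csSup hbd ⟨by linarith [hm.1], by rwa [add_smul, ← add_assoc]⟩
      linarith
    · exact H.outer.convex.segment_subset hp.1 hm.2 hz
    · obtain ⟨t, h1, h2, rfl⟩ := exists_of_mem_segment_ray hm.1 hz
      simp only [Set.mem_iUnion, not_exists]
      exact fun i => hhit i t h1

/-! ### Slanted heights -/

noncomputable def xCoord : Plane →ₗ[ℝ] ℝ := (EuclideanSpace.proj (𝕜 := ℝ) (0 : Fin 2)).toLinearMap

/-- The height above the lines of slope `m`. -/
noncomputable def height (m : ℝ) : Plane →ₗ[ℝ] ℝ :=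
  (EuclideanSpace.proj (𝕜 := ℝ) (1 : Fin 2)).toLinearMap - m • xCoord

noncomputable def upDir : Plane := EuclideanSpace.single 1 1

@[simp] theorem xCoord_apply (z : Plane) : xCoord z = z 0 := rfl

@[simp] theorem height_apply (m : ℝ) (z : Plane) : height m z = z 1 - m * z 0 := rfl

theorem xCoord_upDir : xCoord upDir = 0 := by simp [upDir]

theorem height_upDir (m : ℝ) : height m upDir = 1 := by simp [upDir]

theorem norm_upDir : ‖upDir‖ = 1 := by simp [upDir]

theorem upDir_ne_zero : upDir ≠ 0 := norm_ne_zero_iff.1 (by simp [norm_upDir])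

theorem eq_add_smul_upDir (m : ℝ) {z w : Plane} (h : xCoord w = xCoord z) :
    w = z + (height m w - height m z) • upDir := by
  simp only [xCoord_apply] at h
  ext i
  fin_cases i <;> simp [upDir, h]

theorem abs_sub_apply_le_dist (z w : Plane) (i : Fin 2) : |z i - w i| ≤ dist z w := by
  rw [dist_eq_norm]
  simpa using PiLp.norm_apply_le (z - w) i

theorem dist_le_abs_add_abs (z w : Plane) : dist z w ≤ |z 0 - w 0| + |z 1 - w 1| := by
  rw [EuclideanSpace.dist_eq]
  simp only [Fin.sum_univ_two, Real.dist_eq, sq_abs]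
  refine Real.sqrt_le_iff.2 ⟨by positivity, ?_⟩
  rw [add_sq, sq_abs, sq_abs]
  nlinarith [mul_nonneg (abs_nonneg (z 0 - w 0)) (abs_nonneg (z 1 - w 1))]

/-- Passing from vertical difference to height costs at most one more horizontal difference; this
fixes `A = 2`, `B = 1` for the chains. -/
theorem dist_le_height {m : ℝ} (hm : |m| ≤ 1) (z w : Plane) :
    dist z w ≤ 2 * |xCoord z - xCoord w| + 1 * |height m z - height m w| := by
  have h1 : |z 1 - w 1| ≤ |height m z - height m w| + |m * (z 0 - w 0)| := by
    refine le_trans (le_of_eq ?_) (abs_add_le _ _)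
    congr 1
    simp only [height_apply]; ring
  rw [abs_mul] at h1
  have := mul_le_mul_of_nonneg_right hm (abs_nonneg (z 0 - w 0))
  have h2 := dist_le_abs_add_abs z w
  simp only [xCoord_apply]
  linarith

/-- The horizontal coordinate, growing to the right for `true` and to the left for `false`. -/
noncomputable def sideCoord (b : Bool) : Plane →ₗ[ℝ] ℝ := if b then xCoord else -xCoord

theorem sideCoord_upDir (b : Bool) : sideCoord b upDir = 0 := by
  cases b <;> simp [sideCoord, xCoord_upDir, -xCoord_apply]

theorem abs_sideCoord (b : Bool) (z w : Plane) :
    |sideCoord b z - sideCoord b w| = |xCoord z - xCoord w| := by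
  cases b
  · simp only [sideCoord, Bool.false_eq_true, if_false, LinearMap.neg_apply]
    rw [← abs_neg]; congr 1; ring
  · simp [sideCoord]

theorem isLowest_of_ray {m : ℝ} {K : Set Plane} {q : Plane} (hq : q ∈ K)
    (h : ∀ τ : ℝ, 0 < τ → q - τ • upDir ∉ K) : IsLowest xCoord (height m) K q := by
  refine ⟨hq, fun w hw hx => ?_⟩
  by_contra! hlt
  refine h (height m q - height m w) (by linarith) ?_
  have := eq_add_smul_upDir m hx
  rw [sub_eq_add_neg, ← neg_smul, neg_sub, ← this]
  exact hw

/-! ### Ascending paths -/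

/-- From a lowest point of a hole one gets to one of the two ends of its lower chain. -/
theorem IsConvexPolygon.exists_slide {K : Set Plane} (hK : IsConvexPolygon K) {m δ : ℝ}
    (hm : |m| ≤ 1) (hδ : 0 < δ) {q a b : Plane} {e : Bool → Plane}
    (hq : IsLowest xCoord (height m) K q)
    (he : ∀ s, IsLowest (sideCoord s) (height m) K (e s))
    (hmax : ∀ s, ∀ w ∈ K, sideCoord s w ≤ sideCoord s (e s))
    (haK : a ∈ K) (hbK : b ∈ K)
    (ha : ∀ w ∈ K, height m a + δ * xCoord a ≤ height m w + δ * xCoord w)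
    (hb : ∀ w ∈ K, height m b - δ * xCoord b ≤ height m w - δ * xCoord w) :
    ∃ s, height m q ≤ height m (e s) ∧ geod (K \ interior K) q (e s) ≤
      ENNReal.ofReal (2 * (xCoord b - xCoord a) +
        (2 / δ + 1) * (height m (e s) - height m q)) := by
  obtain ⟨V, hV⟩ := hK.1
  rcases hq.slope_nonneg_or hK.convex with h | h
  · refine ⟨true, geod_slide (X := xCoord) hV xCoord_upDir (height_upDir m) (by norm_num)
      (by norm_num) (dist_le_height hm) hδ hq (he true) (hmax true) h haK hbK ha hb⟩
  -- Mirror image: replacing `X` by `-X` exchanges the roles of `a` and `b`.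
  · have := geod_slide (X := -xCoord) (e := e false) (a := b) (b := a) hV
      (by simp [xCoord_upDir, -xCoord_apply])
      (height_upDir m) (A := 2) (B := 1) (by norm_num)
      (by norm_num) (fun z w => ?_) hδ hq.neg (he false) (hmax false) ?_ hbK haK ?_ ?_
    · refine ⟨false, this.1, this.2.trans_eq ?_⟩
      congr 2
      simp only [LinearMap.neg_apply]; ring
    · have h1 := dist_le_height hm z w
      have h2 := abs_sideCoord false z w
      rw [← h2] at h1
      exact h1
    · intro w hw hx
      exact h w hw (by simpa using hx)
    · intro w hw
      have := hb w hw
      simp only [LinearMap.neg_apply]; linarith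
    · intro w hw
      have := ha w hw
      simp only [LinearMap.neg_apply]; linarith

/-- One move: straight up, then along the lower chain of the hole that is hit. The gain is strict
when `p` is already a chain end: the vertical line through it misses the interior of its own hole,
so the hole hit is a different one, disjoint from it, and the vertical part is not trivial. -/
theorem IsHoled.step {h : ℕ} {K : Set Plane} {Q : Fin h → Set Plane}
    (H : IsHoled K Q) {m δ : ℝ} (hm : |m| ≤ 1) (hδ : 0 < δ) {a b : Fin h → Plane}
    {e : Fin h × Bool → Plane}
    (he : ∀ i s, IsLowest (sideCoord s) (height m) (Q i) (e (i, s)))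
    (hmax : ∀ i s, ∀ w ∈ Q i, sideCoord s w ≤ sideCoord s (e (i, s)))
    (haK : ∀ i, a i ∈ Q i) (hbK : ∀ i, b i ∈ Q i)
    (ha : ∀ i, ∀ w ∈ Q i, height m (a i) + δ * xCoord (a i) ≤ height m w + δ * xCoord w)
    (hb : ∀ i, ∀ w ∈ Q i, height m (b i) - δ * xCoord (b i) ≤ height m w - δ * xCoord w)
    {p : Plane} (hp : p ∈ freeSpace K Q) :
    (∃ z ∈ K, (∀ τ : ℝ, 0 < τ → z + τ • upDir ∉ K) ∧ height m p ≤ height m z ∧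
      geod (freeSpace K Q) p z ≤ ENNReal.ofReal (height m z - height m p)) ∨
    (∃ c : Fin h × Bool, height m p ≤ height m (e c) ∧ (∀ c', p = e c' → height m p < height m (e c)) ∧
      geod (freeSpace K Q) p (e c) ≤ ENNReal.ofReal (2 * (xCoord (b c.1) - xCoord (a c.1)) +
        (2 / δ + 1) * (height m (e c) - height m p))) := by
  have hdist : ∀ T : ℝ, 0 ≤ T → edist p (p + T • upDir) = ENNReal.ofReal T := fun T hT => by
    rw [edist_dist, dist_self_add_right, norm_smul, norm_upDir, mul_one, Real.norm_of_nonneg hT]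
  have hheight : ∀ T : ℝ, height m (p + T • upDir) = height m p + T := fun T => by
    rw [map_add, map_smul, height_upDir, smul_eq_mul, mul_one]
  rcases H.ray hp upDir_ne_zero with ⟨T, hT, hTK, htop, hseg⟩ | ⟨i, T, T', hT, hTT', hTi, hT'i, hseg⟩
  · refine .inl ⟨_, hTK, htop, by rw [hheight]; linarith, ?_⟩
    refine (geod_le_edist hseg).trans ?_
    rw [hdist T hT, hheight]
    simp
  · right
    have hq : p + T • upDir ∉ interior (Q i) := fun hmem =>
      (hseg (right_mem_segment ℝ _ _)).2 (Set.mem_iUnion.2 ⟨i, hmem⟩)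
    -- A point of the hole below the hit point, joined to the interior point above it, would make
    -- the hit point interior.
    have hlow : IsLowest xCoord (height m) (Q i) (p + T • upDir) := by
      refine isLowest_of_ray hTi fun τ hτ hmem => hq ?_
      refine (H.hole i).convex.openSegment_interior_self_subset_interior hT'i hmem ?_
      have hpos : 0 < T' - T + τ := by linarith
      refine ⟨τ / (T' - T + τ), (T' - T) / (T' - T + τ), by positivity,
        div_pos (by linarith) hpos, by field_simp; ring, ?_⟩
      have : τ / (T' - T + τ) * T' + (T' - T) / (T' - T + τ) * (T - τ) = T := by
        field_simp; ring
      have h1 : τ / (T' - T + τ) + (T' - T) / (T' - T + τ) = 1 := by field_simp; ring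
      calc _ = (τ / (T' - T + τ) + (T' - T) / (T' - T + τ)) • p +
          (τ / (T' - T + τ) * T' + (T' - T) / (T' - T + τ) * (T - τ)) • upDir := by module
        _ = _ := by rw [this, h1, one_smul]
    obtain ⟨s, hs1, hs2⟩ := (H.hole i).exists_slide hm hδ hlow (he i) (hmax i) (haK i) (hbK i)
      (ha i) (hb i)
    have hw : 0 ≤ xCoord (b i) - xCoord (a i) := by
      have := ha i _ (hbK i)
      have := hb i _ (haK i)
      nlinarith
    rw [hheight] at hs1
    refine ⟨(i, s), by linarith, ?_, ?_⟩
    · rintro ⟨i', s'⟩ hpe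
      suffices 0 < T by linarith
      have hside : ∀ r : ℝ, sideCoord s' (p + r • upDir) = sideCoord s' p := fun r => by
        rw [map_add, map_smul, sideCoord_upDir, smul_zero, add_zero]
      have hii : i' ≠ i := by
        rintro rfl
        have := notMem_interior_of_isMin (f := -sideCoord s') (K := Q i') (z := p + T' • upDir)
          (d := if s' then -EuclideanSpace.single 0 1 else EuclideanSpace.single 0 1)
          (by cases s' <;> simp [sideCoord]) (fun w hw => by
            have := hmax i' s' w hw
            rw [← hpe] at this
            simp only [LinearMap.neg_apply, hside]
            linarith)
        exact this hT'i
      refine lt_of_le_of_ne hT fun h0 => ?_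
      refine Set.disjoint_left.1 (H.disj i' i hii) (he i' s').1 ?_
      rw [← hpe]
      simpa [← h0] using hTi
    · have hg : 0 < 2 / δ := by positivity
      rw [hheight] at hs2
      refine (geod_le_ofReal_add hT ?_ ((geod_le_edist hseg).trans (hdist T hT).le)
        ((geod_anti (H.boundary_subset i) _ _).trans hs2)).trans (ENNReal.ofReal_le_ofReal ?_)
      · have := mul_nonneg (by linarith : 0 ≤ 2 / δ + 1)
          (by linarith : 0 ≤ height m (e (i, s)) - (height m p + T))
        linarith
      · have := mul_nonneg hg.le hT
        linarith

/-- From every end of a lower chain there is a path to the top of the outer polygon, on which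
each hole is passed at most once on each side. -/
theorem IsHoled.reach_top {h : ℕ} {K : Set Plane} {Q : Fin h → Set Plane}
    (H : IsHoled K Q) {m δ : ℝ} (hm : |m| ≤ 1) (hδ : 0 < δ) {a b : Fin h → Plane}
    {e : Fin h × Bool → Plane}
    (he : ∀ i s, IsLowest (sideCoord s) (height m) (Q i) (e (i, s)))
    (hmax : ∀ i s, ∀ w ∈ Q i, sideCoord s w ≤ sideCoord s (e (i, s)))
    (haK : ∀ i, a i ∈ Q i) (hbK : ∀ i, b i ∈ Q i)
    (ha : ∀ i, ∀ w ∈ Q i, height m (a i) + δ * xCoord (a i) ≤ height m w + δ * xCoord w)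
    (hb : ∀ i, ∀ w ∈ Q i, height m (b i) - δ * xCoord (b i) ≤ height m w - δ * xCoord w)
    (c : Fin h × Bool) :
    ∃ z ∈ K, (∀ τ : ℝ, 0 < τ → z + τ • upDir ∉ K) ∧ height m (e c) ≤ height m z ∧
      geod (freeSpace K Q) (e c) z ≤ ENNReal.ofReal ((2 / δ + 1) * (height m z - height m (e c)) +
        ∑ c' with height m (e c) < height m (e c'),
          2 * (xCoord (b c'.1) - xCoord (a c'.1))) := by
  have hg : 0 < 2 / δ := by positivity
  have hw : ∀ i, 0 ≤ xCoord (b i) - xCoord (a i) := fun i => by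
    have := ha i _ (hbK i)
    have := hb i _ (haK i)
    nlinarith
  -- Induction on the number of chain ends strictly higher than `e c`.
  induction hn : (Finset.univ.filter fun c' => height m (e c) < height m (e c')).card
    using Nat.strong_induction_on generalizing c with
  | _ n ih =>
  have hsum : ∀ c, 0 ≤ ∑ c' with height m (e c) < height m (e c'),
      2 * (xCoord (b c'.1) - xCoord (a c'.1)) := fun c =>
    Finset.sum_nonneg fun c' _ => mul_nonneg (by norm_num) (hw _)
  have hfree : e c ∈ freeSpace K Q := H.boundary_subset c.1
    ⟨(he c.1 c.2).1, (he c.1 c.2).notMem_interior (sideCoord_upDir _) (height_upDir m)⟩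
  rcases H.step hm hδ he hmax haK hbK ha hb hfree with ⟨z, hzK, hz, hle, hgeod⟩ | ⟨c₁, hle, hlt, hgeod⟩
  · refine ⟨z, hzK, hz, hle, hgeod.trans (ENNReal.ofReal_le_ofReal ?_)⟩
    have := mul_nonneg hg.le (sub_nonneg.2 hle)
    linarith [hsum c]
  · replace hlt := hlt c rfl
    -- The charge for `c₁` is not among the charges of the remaining path, which go to ends strictly
    -- above it.
    have hsub : insert c₁ (Finset.univ.filter fun c' => height m (e c₁) < height m (e c')) ⊆
        Finset.univ.filter fun c' => height m (e c) < height m (e c') := by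
      intro c' hc'
      simp only [Finset.mem_insert, Finset.mem_filter, Finset.mem_univ, true_and] at hc' ⊢
      rcases hc' with rfl | h
      · exact hlt
      · exact hlt.trans h
    have hnot : c₁ ∉ Finset.univ.filter fun c' => height m (e c₁) < height m (e c') := by
      simp only [Finset.mem_filter, lt_irrefl, and_false, not_false_eq_true]
    have hcard := Finset.card_le_card hsub
    rw [Finset.card_insert_of_notMem hnot] at hcard
    obtain ⟨z, hzK, hz, hle₁, hgeod₁⟩ := ih _ (by omega) c₁ rfl
    refine ⟨z, hzK, hz, hle.trans hle₁, (geod_le_ofReal_add ?_ ?_ hgeod hgeod₁).trans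
      (ENNReal.ofReal_le_ofReal ?_)⟩
    · exact add_nonneg (mul_nonneg (by norm_num) (hw _))
        (mul_nonneg (by linarith) (sub_nonneg.2 hle))
    · exact add_nonneg (mul_nonneg (by linarith) (sub_nonneg.2 hle₁)) (hsum _)
    · have := Finset.sum_le_sum_of_subset_of_nonneg hsub
        (f := fun c' => 2 * (xCoord (b c'.1) - xCoord (a c'.1)))
        fun c' _ _ => mul_nonneg (by norm_num) (hw _)
      rw [Finset.sum_insert hnot] at this
      linarith

/-- Points of the upper chain are joined to a highest point. -/
theorem IsHoled.geod_highest {h : ℕ} {K : Set Plane} {Q : Fin h → Set Plane}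
    (H : IsHoled K Q) {z t : Plane} (hz : z ∈ K) (hzt : ∀ τ : ℝ, 0 < τ → z + τ • upDir ∉ K)
    (ht : t ∈ K) (htmax : ∀ w ∈ K, w 1 ≤ t 1) :
    geod (freeSpace K Q) z t ≤ ENNReal.ofReal (|z 0 - t 0| + (t 1 - z 1)) := by
  obtain ⟨V, hV⟩ := H.outer.1
  -- Upside down, the upper chain of `K` is a lower chain for `-height 0`, followed from `t` towards
  -- `z`.
  have hlow : ∀ s, IsLowest (sideCoord s) (-height 0) K z := by
    intro s
    refine ⟨hz, fun w hw hx => ?_⟩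
    by_contra! hlt
    simp only [LinearMap.neg_apply, neg_lt_neg_iff] at hlt
    have hx' : xCoord w = xCoord z := by
      have := abs_sideCoord s w z
      rw [hx, sub_self, abs_zero, eq_comm, abs_eq_zero] at this
      linarith
    refine hzt _ (sub_pos.2 hlt) ?_
    rwa [← eq_add_smul_upDir 0 hx']
  have hlowt : ∀ s, IsLowest (sideCoord s) (-height 0) K t := by
    refine fun s => ⟨ht, fun w hw _ => ?_⟩
    simpa using htmax w hw
  obtain ⟨s, hs⟩ : ∃ s, sideCoord s t ≤ sideCoord s z := by
    rcases le_total (t 0) (z 0) with h | h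
    · exact ⟨true, h⟩
    · exact ⟨false, neg_le_neg h⟩
  have := (geod_lower_chain (X := sideCoord s) (Y := -height 0) hV (d := -upDir)
    (by rw [map_neg, sideCoord_upDir, neg_zero]) (by simp [height_upDir, -height_apply])
    (A := 1) (B := 1) zero_le_one zero_le_one ?_ (hlowt s) (hlow s) hs ?_).2
  · rw [geod_comm]
    refine ((geod_anti H.outer_boundary_subset _ _).trans this).trans_eq ?_
    congr 1
    rw [← abs_of_nonneg (sub_nonneg.2 hs), abs_sideCoord]
    simp
    ring
  · intro u w
    rw [abs_sideCoord, one_mul, one_mul]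
    refine (dist_le_abs_add_abs u w).trans_eq ?_
    simp only [xCoord_apply, LinearMap.neg_apply, height_apply, zero_mul, sub_zero]
    rw [neg_sub_neg, abs_sub_comm (w 1)]
  · intro w hw _
    simpa using htmax w hw

/-- Each coordinate attains its extremes over `K` on the outer boundary, which is free; so the
diameter of the free space controls all of `K`. -/
theorem IsHoled.abs_sub_le {h : ℕ} {K : Set Plane} {Q : Fin h → Set Plane}
    (H : IsHoled K Q) {D : ℝ} (hD : ∀ s ∈ freeSpace K Q, ∀ t ∈ freeSpace K Q, dist s t ≤ D)
    (i : Fin 2) {u w : Plane} (hu : u ∈ K) (hw : w ∈ K) : |u i - w i| ≤ D := by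
  have hc : ContinuousOn (fun z : Plane => z i) K := by fun_prop
  obtain ⟨a, ha, hamin⟩ := H.outer.isCompact.exists_isMinOn H.outer.nonempty hc
  obtain ⟨b, hb, hbmax⟩ := H.outer.isCompact.exists_isMaxOn H.outer.nonempty hc
  set f : Plane →ₗ[ℝ] ℝ := (EuclideanSpace.proj (𝕜 := ℝ) i).toLinearMap
  have ha' : a ∈ freeSpace K Q := H.outer_boundary_subset
    ⟨ha, notMem_interior_of_isMin (f := f) (d := EuclideanSpace.single i 1) (by simp [f])
      fun w hw => hamin hw⟩
  have hb' : b ∈ freeSpace K Q := H.outer_boundary_subset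
    ⟨hb, notMem_interior_of_isMin (f := -f) (d := -EuclideanSpace.single i 1) (by simp [f])
      fun w hw => neg_le_neg (hbmax hw)⟩
  have h1 := (abs_sub_apply_le_dist b a i).trans (hD b hb' a ha')
  have h2 : a i ≤ u i := hamin hu
  have h3 : a i ≤ w i := hamin hw
  have h4 : u i ≤ b i := hbmax hu
  have h5 : w i ≤ b i := hbmax hw
  have h6 := le_abs_self (b i - a i)
  rw [abs_le]
  constructor <;> linarith

/-! ### Choice of the slope and the upper bound -/

/-- Among `N` slopes there is one for which the flat parts of the lower chains are short. -/
theorem IsHoled.exists_slope {h : ℕ} {K : Set Plane} {Q : Fin h → Set Plane}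
    (H : IsHoled K Q) {D : ℝ} (hD : ∀ s ∈ freeSpace K Q, ∀ t ∈ freeSpace K Q, dist s t ≤ D)
    {N : ℕ} (hN : 0 < N) :
    ∃ (m : ℝ) (a b : Fin h → Plane), |m| ≤ 1 ∧ (∀ i, a i ∈ Q i) ∧ (∀ i, b i ∈ Q i) ∧
      (∀ i, ∀ w ∈ Q i, height m (a i) + 1 / (2 * N) * xCoord (a i) ≤
        height m w + 1 / (2 * N) * xCoord w) ∧
      (∀ i, ∀ w ∈ Q i, height m (b i) - 1 / (2 * N) * xCoord (b i) ≤
        height m w - 1 / (2 * N) * xCoord w) ∧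
      ∑ i, (xCoord (b i) - xCoord (a i)) ≤ h * D / N := by
  have hN' : (0 : ℝ) < N := by exact_mod_cast hN
  have hex : ∀ (i : Fin h) (j : ℕ), ∃ p ∈ Q i, ∀ w ∈ Q i, height (j / N) p ≤ height (j / N) w := by
    intro i j
    obtain ⟨p, hp, hmin⟩ := (H.hole i).isCompact.exists_isMinOn (H.hole i).nonempty
      (height (j / N)).continuous_of_finiteDimensional.continuousOn
    exact ⟨p, hp, fun w hw => hmin hw⟩
  choose p hp hmin using hex
  -- `p i j` minimizes the height of slope `j / N` on hole `i`. For a fixed hole the widths between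
  -- consecutive minimizers telescope to at most `D`; averaging over `j` finds a good window.
  have htel : ∑ j ∈ Finset.range N, ∑ i, (xCoord (p i (j + 1)) - xCoord (p i j)) ≤
      ∑ j ∈ Finset.range N, h * D / N := by
    rw [Finset.sum_comm]
    calc _ ≤ ∑ _i : Fin h, D := Finset.sum_le_sum fun i _ => by
          rw [Finset.sum_range_sub (fun j => xCoord (p i j))]
          exact (le_abs_self _).trans (H.abs_sub_le hD 0 (interior_subset (H.sub i (hp i N)))
            (interior_subset (H.sub i (hp i 0))))
      _ = _ := by simp; field_simp
  obtain ⟨j, hj, hle⟩ := Finset.exists_le_of_sum_le ⟨0, by simpa using hN⟩ htel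
  have hjN : (j : ℝ) + 1 ≤ N := by exact_mod_cast Finset.mem_range.1 hj
  -- The midpoint of the window: adding or subtracting `1 / (2 * N)` gives its ends `j / N` and `(j
  -- + 1) / N`.
  refine ⟨(2 * j + 1) / (2 * N), fun i => p i j, fun i => p i (j + 1), ?_, fun i => hp i j,
    fun i => hp i (j + 1), fun i w hw => ?_, fun i w hw => ?_, hle⟩
  · rw [abs_of_nonneg (by positivity), div_le_one (by positivity)]
    linarith
  · convert hmin i j w hw using 1 <;> simp only [height_apply, xCoord_apply] <;> field_simp <;> ring
  · convert hmin i (j + 1) w hw using 1 <;> simp only [height_apply, xCoord_apply] <;>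
      push_cast <;> field_simp <;> ring

/-- The total height gain is at most `2 * D`, at rate `2 / δ + 1 = 4 * N + 1`. The first slide,
which does not start from a chain end, is paid for separately by `2 * D`; the later flat parts cost
at most twice the flat width on each of two sides. -/
theorem IsHoled.exists_top {h : ℕ} {K : Set Plane} {Q : Fin h → Set Plane}
    (H : IsHoled K Q) {D : ℝ} (hD : ∀ s ∈ freeSpace K Q, ∀ t ∈ freeSpace K Q, dist s t ≤ D)
    {N : ℕ} (hN : 0 < N) {s : Plane} (hs : s ∈ freeSpace K Q) :
    ∃ z ∈ K, (∀ τ : ℝ, 0 < τ → z + τ • upDir ∉ K) ∧ geod (freeSpace K Q) s z ≤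
      ENNReal.ofReal ((4 * N + 1) * (2 * D) + 2 * D + 4 * (h * D / N)) := by
  obtain ⟨m, a, b, hm, haQ, hbQ, ha, hb, hsum⟩ := H.exists_slope hD hN
  have hN' : (0 : ℝ) < N := by exact_mod_cast hN
  have hD0 : 0 ≤ D := dist_nonneg.trans (hD s hs s hs)
  have hδ : (0 : ℝ) < 1 / (2 * N) := by positivity
  have hδ' : 2 / (1 / (2 * N : ℝ)) + 1 = 4 * N + 1 := by field_simp; ring
  have hw : ∀ i, 0 ≤ xCoord (b i) - xCoord (a i) := fun i => by
    have := ha i _ (hbQ i)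
    have := hb i _ (haQ i)
    nlinarith
  have hwD : ∀ i, xCoord (b i) - xCoord (a i) ≤ D := fun i =>
    (le_abs_self _).trans (H.abs_sub_le hD 0 (interior_subset (H.sub i (hbQ i)))
            (interior_subset (H.sub i (haQ i))))
  have hrange : ∀ u ∈ K, ∀ w ∈ K, height m u - height m w ≤ 2 * D := by
    intro u hu w hw
    have h0 := H.abs_sub_le hD 0 hu hw
    have h1 := (le_abs_self _).trans (H.abs_sub_le hD 1 hu hw)
    have h2 : -(m * (u 0 - w 0)) ≤ D := by
      refine (neg_le_abs _).trans ?_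
      rw [abs_mul]
      calc _ ≤ 1 * D := mul_le_mul hm h0 (abs_nonneg _) zero_le_one
        _ = D := one_mul D
    simp only [height_apply]
    linarith
  have hex : ∀ c : Fin h × Bool, ∃ e, IsLowest (sideCoord c.2) (height m) (Q c.1) e ∧
      ∀ w ∈ Q c.1, sideCoord c.2 w ≤ sideCoord c.2 e := fun c =>
    exists_isLowest_max (H.hole c.1).isCompact (H.hole c.1).nonempty _ _
  choose e he hmax using hex
  have he' := fun i s => he (i, s)
  have hmax' := fun i s => hmax (i, s)
  rcases H.step hm hδ he' hmax' haQ hbQ ha hb hs with ⟨z, hzK, hz, hle, hgeod⟩ | ⟨c, hle, -, hgeod⟩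
  · refine ⟨z, hzK, hz, hgeod.trans (ENNReal.ofReal_le_ofReal ?_)⟩
    have h1 : (0 : ℝ) ≤ 4 * (h * D / N) := by positivity
    have h2 : 0 ≤ N * D := by positivity
    linarith [hrange z hzK s hs.1]
  · obtain ⟨z, hzK, hz, hle', hgeod'⟩ := H.reach_top hm hδ he' hmax' haQ hbQ ha hb c
    refine ⟨z, hzK, hz, ?_⟩
    rw [hδ'] at hgeod hgeod'
    have hnn : ∀ c' : Fin h × Bool, 0 ≤ 2 * (xCoord (b c'.1) - xCoord (a c'.1)) := fun c' =>
      mul_nonneg (by norm_num) (hw _)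
    refine (geod_le_ofReal_add ?_ ?_ hgeod hgeod').trans (ENNReal.ofReal_le_ofReal ?_)
    · exact add_nonneg (hnn c) (mul_nonneg (by positivity) (sub_nonneg.2 hle))
    · exact add_nonneg (mul_nonneg (by positivity) (sub_nonneg.2 hle'))
        (Finset.sum_nonneg fun c' _ => hnn c')
    · have h1 : ∑ c' with height m (e c) < height m (e c'),
          2 * (xCoord (b c'.1) - xCoord (a c'.1)) ≤ 4 * (h * D / N) := by
        refine (Finset.sum_le_sum_of_subset_of_nonneg (Finset.subset_univ _)
          fun c' _ _ => hnn c').trans ?_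
        rw [Fintype.sum_prod_type]
        simp only [Finset.sum_const, Finset.card_univ, Fintype.card_bool, nsmul_eq_mul]
        rw [← Finset.mul_sum, ← Finset.mul_sum]
        push_cast
        linarith
      have h2 := mul_le_mul_of_nonneg_left (hrange z hzK s hs.1)
        (by positivity : (0 : ℝ) ≤ 4 * N + 1)
      linarith [hwD c.1]

theorem IsHoled.geod_le {h : ℕ} {K : Set Plane} {Q : Fin h → Set Plane}
    (H : IsHoled K Q) {D : ℝ} (hD : ∀ s ∈ freeSpace K Q, ∀ t ∈ freeSpace K Q, dist s t ≤ D)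
    (hh : 1 ≤ h) {s t : Plane} (hs : s ∈ freeSpace K Q) (ht : t ∈ freeSpace K Q) :
    geod (freeSpace K Q) s t ≤ ENNReal.ofReal (52 * √h * D) := by
  have hh' : (1 : ℝ) ≤ h := by exact_mod_cast hh
  have hsq : 1 ≤ √(h : ℝ) := Real.one_le_sqrt.2 hh'
  have hsq' : √(h : ℝ) * √h = h := Real.mul_self_sqrt (by linarith)
  have hD0 : 0 ≤ D := dist_nonneg.trans (hD s hs s hs)
  -- Balances `N * D` against `h * D / N`. With `N ≤ 2 * √h` the cost is (16 + 2) + 2 + 4 for the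
  -- ascent and 2 for the outer boundary, hence 26 for each of the two points.
  set N := ⌈√(h : ℝ)⌉₊
  have hN : 0 < N := Nat.ceil_pos.2 (by linarith)
  have hN1 : √(h : ℝ) ≤ N := Nat.le_ceil _
  have hN2 : (N : ℝ) < √h + 1 := Nat.ceil_lt_add_one (by linarith)
  have hc : ContinuousOn (fun z : Plane => z 1) K := by fun_prop
  obtain ⟨u, hu, humax⟩ := H.outer.isCompact.exists_isMaxOn H.outer.nonempty hc
  have key : ∀ s ∈ freeSpace K Q, geod (freeSpace K Q) s u ≤ ENNReal.ofReal (26 * √h * D) := by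
    intro s hs
    obtain ⟨z, hzK, hz, hgeod⟩ := H.exists_top hD hN hs
    have hhN : h * D / N ≤ √h * D := by
      rw [div_le_iff₀ (by linarith)]
      nlinarith [mul_le_mul_of_nonneg_right hN1 (by positivity : 0 ≤ √h * D)]
    refine (geod_le_ofReal_add (by positivity) ?_ hgeod
      (H.geod_highest hzK hz hu fun w hw => humax hw)).trans (ENNReal.ofReal_le_ofReal ?_)
    · exact add_nonneg (abs_nonneg _) (sub_nonneg.2 (humax hzK))
    · have h0 := H.abs_sub_le hD 0 hzK hu
      have h1 := (le_abs_self _).trans (H.abs_sub_le hD 1 hu hzK)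
      have h2 : N * D ≤ 2 * √h * D := mul_le_mul_of_nonneg_right (by linarith) hD0
      have h3 : D ≤ √h * D := le_mul_of_one_le_left hD0 hsq
      linarith
  refine (geod_le_ofReal_add (by positivity) (by positivity) (key s hs)
    ((geod_comm _ _ _).trans_le (key t ht))).trans_eq ?_
  congr 1
  ring

theorem distortion_le {h : ℕ} (hh : 1 ≤ h) {P : Set Plane} (hP : P ∈ convexDomains h) :
    distortion P ≤ ENNReal.ofReal (52 * √h) := by
  obtain ⟨K, Q, hK, hQ, hsub, hdisj, rfl⟩ := hP
  have H : IsHoled K Q := ⟨hK, hQ, hsub, hdisj⟩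
  change distortion (freeSpace K Q) ≤ _
  have hfin : euclideanDiam (freeSpace K Q) ≠ ∞ := by
    obtain ⟨R, hR⟩ := Metric.isBounded_iff.1 H.outer.isCompact.isBounded
    refine ne_top_of_le_ne_top (ENNReal.ofReal_ne_top (r := R)) ?_
    refine iSup₂_le fun s hs => iSup₂_le fun t ht => ?_
    rw [edist_dist]
    exact ENNReal.ofReal_le_ofReal (hR hs.1 ht.1)
  have hD : ∀ s ∈ freeSpace K Q, ∀ t ∈ freeSpace K Q,
      dist s t ≤ (euclideanDiam (freeSpace K Q)).toReal := by
    intro s hs t ht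
    rw [dist_edist]
    exact ENNReal.toReal_mono hfin (le_iSup₂_of_le s hs (le_iSup₂_of_le t ht le_rfl))
  refine ENNReal.div_le_of_le_mul (iSup₂_le fun s hs => iSup₂_le fun t ht => ?_)
  refine (H.geod_le hD hh hs ht).trans_eq ?_
  rw [ENNReal.ofReal_mul (by positivity), ENNReal.ofReal_toReal hfin]

/-! ### From compact convex sets to domains -/

/-- Disjoint compact convex sets can be replaced by disjoint convex holes containing them. -/
theorem exists_convexDomain {h : ℕ} (S : Fin h → Set Plane) (hcomp : ∀ i, IsCompact (S i))
    (hconv : ∀ i, Convex ℝ (S i)) (hne : ∀ i, (S i).Nonempty)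
    (hdisj : ∀ i j, i ≠ j → Disjoint (S i) (S j)) {R : ℝ} (hR : 0 ≤ R)
    (hball : ∀ i, S i ⊆ Metric.closedBall 0 R) {t : Plane} (ht : ‖t‖ ≤ R)
    (h0S : ∀ i, (0 : Plane) ∉ S i) (htS : ∀ i, t ∉ S i) :
    ∃ P ∈ convexDomains h, 0 ∈ P ∧ t ∈ P ∧ (∀ i, Disjoint (S i) P) ∧
      euclideanDiam P ≤ ENNReal.ofReal (2 * (R + 1)) := by
  obtain ⟨V, hV1, hV2⟩ := (convex_closedBall (0 : Plane) R).exists_subset_interior_convexHull_finset_of_isCompact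
    (isCompact_closedBall 0 R) (t := Metric.closedBall 0 (R + 1)) (by
      rw [mem_nhdsSet_iff_forall]
      intro x hx
      refine Metric.closedBall_mem_nhds_of_mem ?_
      simp at hx ⊢; linarith)
  set K := convexHull ℝ (V : Set Plane)
  have hK : IsConvexPolygon K := ⟨⟨V, rfl⟩, ⟨0, hV1 (by simpa using hR)⟩⟩
  have hclosed : IsClosed ({0, t} : Set Plane) := (Set.toFinite _).isClosed
  have hδ1 : ∀ i, ∀ᶠ δ in nhdsWithin (0 : ℝ) (Set.Ioi 0),
      Metric.thickening δ (S i) ⊆ interior K \ {0, t} := by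
    intro i
    obtain ⟨δ, hδ, hsub⟩ := (hcomp i).exists_thickening_subset_open
      (isOpen_interior.sdiff hclosed) (t := interior K \ {0, t}) (fun z hz => ⟨hV1 (hball i hz), by
        rintro (rfl | rfl)
        · exact h0S i hz
        · exact htS i hz⟩)
    filter_upwards [Ioo_mem_nhdsGT hδ] with δ' h'
    exact (Metric.thickening_mono h'.2.le _).trans hsub
  have hδ2 : ∀ i j, ∀ᶠ δ in nhdsWithin (0 : ℝ) (Set.Ioi 0), i ≠ j →
      Disjoint (Metric.thickening δ (S i)) (Metric.thickening δ (S j)) := by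
    intro i j
    rcases eq_or_ne i j with hij | hij
    · exact .of_forall fun _ h => absurd hij h
    · obtain ⟨δ, hδ, hd⟩ := (hdisj i j hij).exists_thickenings (hcomp i) (hcomp j).isClosed
      filter_upwards [Ioo_mem_nhdsGT hδ] with δ' h' _
      exact hd.mono (Metric.thickening_mono h'.2.le _) (Metric.thickening_mono h'.2.le _)
  -- One thickness for all the sets: the thickenings stay inside `K`, miss `0` and `t`, and remain
  -- disjoint. A polygon is then squeezed between each set and its thickening.
  obtain ⟨δ, ⟨h1, h2⟩, hδ⟩ := (((Filter.eventually_all.2 hδ1).and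
    (Filter.eventually_all.2 fun i => Filter.eventually_all.2 (hδ2 i))).and
      self_mem_nhdsWithin).exists
  have hex : ∀ i, ∃ W : Finset Plane, S i ⊆ interior (convexHull ℝ (W : Set Plane)) ∧
      convexHull ℝ (W : Set Plane) ⊆ Metric.thickening δ (S i) := fun i =>
    (hconv i).exists_subset_interior_convexHull_finset_of_isCompact (hcomp i)
      (Metric.isOpen_thickening.mem_nhdsSet.2 (Metric.self_subset_thickening hδ _))
  choose W hW1 hW2 using hex
  have havoid : ∀ z ∈ ({0, t} : Set Plane), z ∈ K →
      z ∈ K \ ⋃ i, interior (convexHull ℝ (W i : Set Plane)) := by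
    refine fun z hz hzK => ⟨hzK, ?_⟩
    simp only [Set.mem_iUnion, not_exists]
    exact fun i hi => (h1 i (hW2 i (interior_subset hi))).2 hz
  refine ⟨K \ ⋃ i, interior (convexHull ℝ (W i : Set Plane)),
    ⟨K, fun i => convexHull ℝ (W i : Set Plane), hK,
      fun i => ⟨⟨W i, rfl⟩, (hne i).mono (hW1 i)⟩,
      fun i => (hW2 i).trans ((h1 i).trans Set.sdiff_subset),
      fun i j hij => (h2 i j hij).mono (hW2 i) (hW2 j), rfl⟩,
    havoid 0 (by simp) (interior_subset (hV1 (by simpa using hR))),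
    havoid t (by simp) (interior_subset (hV1 (by simpa using ht))), fun i => ?_, ?_⟩
  · rw [Set.disjoint_left]
    exact fun z hz hzP => hzP.2 (Set.mem_iUnion.2 ⟨i, hW1 i hz⟩)
  · refine iSup₂_le fun x hx => iSup₂_le fun y hy => ?_
    rw [edist_dist]
    refine ENNReal.ofReal_le_ofReal ?_
    have hx' := hV2 hx.1
    have hy' := hV2 hy.1
    rw [Metric.mem_closedBall] at hx' hy'
    linarith [dist_triangle_right x y 0]

theorem euclideanDiam_le_geodesicDiam (P : Set Plane) : euclideanDiam P ≤ geodesicDiam P :=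
  iSup₂_mono fun s _ => iSup₂_mono fun t _ => edist_le_geod P s t

theorem edist_le_euclideanDiam {P : Set Plane} {s t : Plane} (hs : s ∈ P) (ht : t ∈ P) :
    edist s t ≤ euclideanDiam P :=
  le_iSup₂_of_le s hs (le_iSup₂_of_le t ht le_rfl)

theorem geod_le_geodesicDiam {P : Set Plane} {s t : Plane} (hs : s ∈ P) (ht : t ∈ P) :
    geod P s t ≤ geodesicDiam P :=
  le_iSup₂_of_le s hs (le_iSup₂_of_le t ht le_rfl)

theorem one_le_distortion {P : Set Plane} {s t : Plane} (hs : s ∈ P) (ht : t ∈ P) (hst : s ≠ t)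
    (hfin : euclideanDiam P ≠ ∞) : 1 ≤ distortion P := by
  have h0 : euclideanDiam P ≠ 0 := fun h => hst (edist_le_zero.1
    ((edist_le_euclideanDiam hs ht).trans h.le))
  rw [distortion, ENNReal.le_div_iff_mul_le (.inl h0) (.inl hfin), one_mul]
  exact euclideanDiam_le_geodesicDiam P

theorem ofReal_div_le_distortion {P : Set Plane} {s t : Plane} {a b : ℝ} (hs : s ∈ P) (ht : t ∈ P)
    (hb : 0 < b) (ha : ENNReal.ofReal a ≤ geod P s t)
    (hdiam : euclideanDiam P ≤ ENNReal.ofReal b) : ENNReal.ofReal (a / b) ≤ distortion P := by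
  rw [ENNReal.ofReal_div_of_pos hb]
  exact ENNReal.div_le_div (ha.trans (geod_le_geodesicDiam hs ht)) hdiam

/-! ### Rotated frames and regular polygons -/

/-- Coordinate in the direction of the angle `θ`. -/
noncomputable def radial (θ : ℝ) : Plane →ₗ[ℝ] ℝ :=
  Real.cos θ • xCoord + Real.sin θ • height 0

/-- Coordinate orthogonal to the direction of the angle `θ`. -/
noncomputable def tangential (θ : ℝ) : Plane →ₗ[ℝ] ℝ :=
  Real.cos θ • height 0 - Real.sin θ • xCoord

theorem radial_apply (θ : ℝ) (z : Plane) : radial θ z = Real.cos θ * z 0 + Real.sin θ * z 1 := by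
  simp [radial]

theorem tangential_apply (θ : ℝ) (z : Plane) :
    tangential θ z = Real.cos θ * z 1 - Real.sin θ * z 0 := by
  simp [tangential]

/-- The point with given coordinates in the frame at the angle `θ`. -/
noncomputable def polarPoint (θ r p : ℝ) : Plane :=
  !₂[r * Real.cos θ - p * Real.sin θ, r * Real.sin θ + p * Real.cos θ]

theorem polarPoint_radial_tangential (θ : ℝ) (z : Plane) :
    polarPoint θ (radial θ z) (tangential θ z) = z := by
  have := Real.sin_sq_add_cos_sq θ
  ext i
  fin_cases i
  · simp [polarPoint, radial_apply, tangential_apply]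
    linear_combination z 0 * this
  · simp [polarPoint, radial_apply, tangential_apply]
    linear_combination z 1 * this

theorem radial_polarPoint (θ r p : ℝ) : radial θ (polarPoint θ r p) = r := by
  have := Real.sin_sq_add_cos_sq θ
  simp [polarPoint, radial_apply]
  linear_combination r * this

theorem tangential_polarPoint (θ r p : ℝ) : tangential θ (polarPoint θ r p) = p := by
  have := Real.sin_sq_add_cos_sq θ
  simp [polarPoint, tangential_apply]
  linear_combination p * this

theorem radial_add (θ φ : ℝ) (z : Plane) :
    radial (θ + φ) z = Real.cos φ * radial θ z + Real.sin φ * tangential θ z := by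
  simp only [radial_apply, tangential_apply, Real.cos_add, Real.sin_add]
  ring

theorem radial_sub_add_radial_add (θ φ : ℝ) (z : Plane) :
    radial (θ - φ) z + radial (θ + φ) z = 2 * Real.cos φ * radial θ z := by
  rw [sub_eq_add_neg, radial_add, radial_add, Real.cos_neg, Real.sin_neg]
  ring

/-- A multiple of π/k that is not a multiple of 2π stays at angular distance at least π/k from 0;
reduce mod `2 * k` and reflect at π. -/
theorem cos_mul_int_le {k : ℕ} (hk : 0 < k) {n : ℤ} (hn : ¬ (2 * k : ℤ) ∣ n) :
    Real.cos (Real.pi / k * n) ≤ Real.cos (Real.pi / k) := by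
  have hk' : (0 : ℝ) < k := by exact_mod_cast hk
  have hk2 : (0 : ℤ) < 2 * k := by exact_mod_cast Nat.mul_pos two_pos hk
  have ha : 0 < Real.pi / k := div_pos Real.pi_pos hk'
  have hak : Real.pi / k * k = Real.pi := div_mul_cancel₀ _ hk'.ne'
  have hr0 := Int.emod_nonneg n hk2.ne'
  have hr1 := Int.emod_lt_of_pos n hk2
  have hr2 : n % (2 * k) ≠ 0 := fun h => hn (Int.dvd_of_emod_eq_zero h)
  have hcos : Real.cos (Real.pi / k * n) = Real.cos (Real.pi / k * (n % (2 * k) : ℤ)) := by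
    have : (n : ℝ) = (n % (2 * k) : ℤ) + 2 * k * (n / (2 * k) : ℤ) := by
      exact_mod_cast (Int.emod_add_mul_ediv n (2 * k)).symm
    rw [this, mul_add, show Real.pi / k * (2 * k * (n / (2 * k) : ℤ)) =
      (n / (2 * k) : ℤ) * (2 * (Real.pi / k * k)) by ring, hak, Real.cos_add_int_mul_two_pi]
  rw [hcos]
  set r := n % (2 * k)
  rcases le_total r k with h | h
  · have h1 : (1 : ℝ) ≤ r := by exact_mod_cast (by omega : 1 ≤ r)
    have h2 : (r : ℝ) ≤ k := by exact_mod_cast h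
    refine Real.cos_le_cos_of_nonneg_of_le_pi ha.le ?_ ?_
    · calc _ ≤ Real.pi / k * k := by gcongr
        _ = _ := hak
    · exact le_mul_of_one_le_right ha.le h1
  · have h1 : (1 : ℝ) ≤ 2 * k - r := by exact_mod_cast (by omega : 1 ≤ 2 * k - r)
    have h2 : (2 * k - r : ℝ) ≤ k := by exact_mod_cast (by omega : 2 * k - r ≤ k)
    rw [← Real.cos_two_pi_sub, show 2 * Real.pi - Real.pi / k * r = Real.pi / k * (2 * k - r) by
      rw [mul_sub, show Real.pi / k * (2 * k) = 2 * (Real.pi / k * k) by ring, hak]]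
    refine Real.cos_le_cos_of_nonneg_of_le_pi ha.le ?_ ?_
    · calc _ ≤ Real.pi / k * k := by gcongr
        _ = _ := hak
    · exact le_mul_of_one_le_right ha.le h1

theorem abs_cos_mul_int_le {k : ℕ} (hk : 0 < k) {n : ℤ} (hn : ¬ (k : ℤ) ∣ n) :
    |Real.cos (Real.pi / k * n)| ≤ Real.cos (Real.pi / k) := by
  have hk' : (0 : ℝ) < k := by exact_mod_cast hk
  rw [abs_le']
  refine ⟨cos_mul_int_le hk fun h => hn (dvd_of_mul_left_dvd h), ?_⟩
  have := cos_mul_int_le hk (n := n + k) fun h => hn ((dvd_add_left (dvd_refl _)).1 (dvd_of_mul_left_dvd h))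
  rwa [Int.cast_add, Int.cast_natCast, mul_add, div_mul_cancel₀ _ hk'.ne', Real.cos_add_pi] at this

/-- The angle between the two points is at least π/k and both radii are at least 1, so by the law of
cosines the distance is at least the chord 2 sin(π/(2k)), which Jordan's inequality bounds by 2/k.
-/
theorem dist_polarPoint_ge {k : ℕ} (hk : 0 < k) {n n' : ℤ} (hn : ¬ (2 * k : ℤ) ∣ n - n') {s s' : ℝ}
    (hs : 1 ≤ s) (hs' : 1 ≤ s') :
    2 / k ≤ dist (polarPoint (Real.pi / k * n) s 0) (polarPoint (Real.pi / k * n') s' 0) := by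
  have hk' : (1 : ℝ) ≤ k := by exact_mod_cast hk
  have hcos := cos_mul_int_le hk hn
  rw [Int.cast_sub, mul_sub, Real.cos_sub] at hcos
  have hsin : 1 / k ≤ Real.sin (Real.pi / k / 2) := by
    have := Real.mul_le_sin (x := Real.pi / k / 2) (by positivity) (by
      gcongr; exact div_le_self Real.pi_pos.le hk')
    refine le_trans (le_of_eq ?_) this
    field_simp
  have hsq : Real.cos (Real.pi / k) = 1 - 2 * Real.sin (Real.pi / k / 2) ^ 2 := by
    have := Real.cos_two_mul (Real.pi / k / 2)
    rw [mul_div_cancel₀ _ two_ne_zero] at this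
    rw [this, Real.cos_sq']; ring
  have hsin2 : (1 / k : ℝ) ^ 2 ≤ Real.sin (Real.pi / k / 2) ^ 2 := by gcongr
  rw [EuclideanSpace.dist_eq]
  refine Real.le_sqrt_of_sq_le ?_
  simp only [Fin.sum_univ_two, Real.dist_eq, sq_abs, polarPoint, zero_mul, sub_zero, add_zero]
  simp only [Matrix.cons_val_zero, Matrix.cons_val_one]
  have h1 := Real.sin_sq_add_cos_sq (Real.pi / k * n)
  have h2 := Real.sin_sq_add_cos_sq (Real.pi / k * n')
  set c := Real.cos (Real.pi / k * n)
  set d := Real.sin (Real.pi / k * n)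
  set c' := Real.cos (Real.pi / k * n')
  set d' := Real.sin (Real.pi / k * n')
  have h3 : (s * c - s' * c') ^ 2 + (s * d - s' * d') ^ 2 =
      (s - s') ^ 2 + 2 * (s * s') * (1 - (c * c' + d * d')) := by
    linear_combination s ^ 2 * h1 + s' ^ 2 * h2
  have h4 : (2 / k : ℝ) ^ 2 = 4 * (1 / k) ^ 2 := by ring
  have h5 : 2 * (1 / k : ℝ) ^ 2 ≤ 1 - (c * c' + d * d') := by linarith
  have h6 : 1 ≤ s * s' := by nlinarith
  have h7 : 0 ≤ (1 / k : ℝ) ^ 2 := by positivity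
  rw [h3, h4]
  nlinarith [sq_nonneg (s - s'), mul_nonneg (sub_nonneg.2 h6) (h7.trans (by linarith : _ ≤ 1 - (c * c' + d * d')))]

/-- A segment with unit normal at angle `θ`, centred at the foot of the perpendicular from the
origin, of half-length `T`. -/
def side (θ r T : ℝ) : Set Plane := {z | radial θ z = r ∧ |tangential θ z| ≤ T}

theorem side_eq_image (θ r T : ℝ) : side θ r T = polarPoint θ r '' Set.Icc (-T) T := by
  ext z
  constructor
  · rintro ⟨h1, h2⟩
    exact ⟨tangential θ z, abs_le.1 h2, by rw [← h1, polarPoint_radial_tangential]⟩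
  · rintro ⟨p, hp, rfl⟩
    exact ⟨radial_polarPoint θ r p, by rw [tangential_polarPoint]; exact abs_le.2 hp⟩

theorem isCompact_side (θ r T : ℝ) : IsCompact (side θ r T) := by
  rw [side_eq_image]
  refine isCompact_Icc.image ?_
  refine (PiLp.continuous_toLp 2 _).comp (continuous_pi fun i => ?_)
  fin_cases i <;> simp <;> fun_prop

theorem convex_side (θ r T : ℝ) : Convex ℝ (side θ r T) := by
  have : side θ r T = radial θ ⁻¹' {r} ∩ tangential θ ⁻¹' Set.Icc (-T) T := by
    ext z
    simp [side, abs_le]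
  rw [this]
  exact ((convex_singleton r).linear_preimage _).inter ((convex_Icc _ _).linear_preimage _)

theorem side_nonempty (θ r : ℝ) {T : ℝ} (hT : 0 ≤ T) : (side θ r T).Nonempty :=
  ⟨polarPoint θ r 0, radial_polarPoint θ r 0, by rwa [tangential_polarPoint, abs_zero]⟩

theorem norm_le_of_mem_side {θ r T : ℝ} {z : Plane} (hz : z ∈ side θ r T) (hr : 0 ≤ r) :
    ‖z‖ ≤ 2 * (r + T) := by
  obtain ⟨h1, h2⟩ := hz
  have h3 := dist_le_abs_add_abs z 0
  rw [dist_zero_right] at h3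
  simp only [PiLp.zero_apply, sub_zero] at h3
  have key : ∀ c d : ℝ, |c| ≤ 1 → |d| ≤ 1 → |r * c + tangential θ z * d| ≤ r + T := by
    intro c d hc hd
    refine (abs_add_le _ _).trans ?_
    rw [abs_mul, abs_mul, abs_of_nonneg hr]
    have := mul_le_mul h2 hd (abs_nonneg _) ((abs_nonneg _).trans h2)
    have := mul_le_mul_of_nonneg_left hc hr
    linarith
  have hz0 : z 0 = r * Real.cos θ + tangential θ z * (-Real.sin θ) := by
    conv_lhs => rw [← polarPoint_radial_tangential θ z, h1]
    simp [polarPoint]; ring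
  have hz1 : z 1 = r * Real.sin θ + tangential θ z * Real.cos θ := by
    conv_lhs => rw [← polarPoint_radial_tangential θ z, h1]
    simp [polarPoint]
  have h4 := key _ _ (Real.abs_cos_le_one θ) ((abs_neg _).trans_le (Real.abs_sin_le_one θ))
  have h5 := key _ _ (Real.abs_sin_le_one θ) (Real.abs_cos_le_one θ)
  rw [← hz0] at h4
  rw [← hz1] at h5
  linarith

theorem dist_polarPoint_same (θ r p p' : ℝ) :
    dist (polarPoint θ r p) (polarPoint θ r p') = |p - p'| := by
  rw [EuclideanSpace.dist_eq]
  simp only [Fin.sum_univ_two, Real.dist_eq, sq_abs, polarPoint]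
  simp only [Matrix.cons_val_zero, Matrix.cons_val_one]
  rw [← Real.sqrt_sq_eq_abs]
  congr 1
  linear_combination (p - p') ^ 2 * Real.sin_sq_add_cos_sq θ

/-- The ends of a full polygon side, at offset `r * tan a`, are the corners. -/
theorem polarPoint_corner (θ r : ℝ) {a : ℝ} (ha : Real.cos a ≠ 0) :
    polarPoint θ r (r * Real.tan a) = polarPoint (θ + a) (r / Real.cos a) 0 := by
  ext i
  fin_cases i
  · simp [polarPoint, Real.tan_eq_sin_div_cos, Real.cos_add]
    field_simp
  · simp [polarPoint, Real.tan_eq_sin_div_cos, Real.sin_add]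
    field_simp

theorem pi_div_mem_Ioc {k : ℕ} (hk : 4 ≤ k) : 0 < Real.pi / k ∧ Real.pi / k ≤ Real.pi / 4 := by
  have hk' : (4 : ℝ) ≤ k := by exact_mod_cast hk
  refine ⟨by positivity, ?_⟩
  gcongr

theorem sin_cos_pi_div_pos {k : ℕ} (hk : 4 ≤ k) :
    0 < Real.sin (Real.pi / k) ∧ 0 < Real.cos (Real.pi / k) := by
  obtain ⟨h1, h2⟩ := pi_div_mem_Ioc hk
  have := Real.pi_pos
  exact ⟨Real.sin_pos_of_pos_of_lt_pi h1 (by linarith),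
    Real.cos_pos_of_mem_Ioo ⟨by linarith, by linarith⟩⟩

/-- A shortened side lies strictly below the lines carrying the other sides. -/
theorem radial_lt_of_mem_side {k : ℕ} (hk : 4 ≤ k) {n j : ℤ} {r T : ℝ} (hr : 0 < r)
    (hT : T < r * Real.tan (Real.pi / k)) {z : Plane} (hz : z ∈ side (Real.pi / k * n) r T)
    (hj : ¬ (k : ℤ) ∣ j) : radial (Real.pi / k * (n + 2 * j : ℤ)) z < r := by
  obtain ⟨hs, hc⟩ := sin_cos_pi_div_pos hk
  obtain ⟨h1, h2⟩ := hz
  have hcj := abs_cos_mul_int_le (by omega : 0 < k) hj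
  -- Normals of one polygon differ by even multiples of π/k. With α = πj/k the new coordinate is r
  -- cos 2α + p sin 2α = r − 2 sin α (r sin α − p cos α).
  rw [show Real.pi / k * (n + 2 * j : ℤ) = Real.pi / k * n + 2 * (Real.pi / k * j) by
    push_cast; ring, radial_add, h1, Real.cos_two_mul', Real.sin_two_mul]
  have hsc := Real.sin_sq_add_cos_sq (Real.pi / k * j)
  have hsc' := Real.sin_sq_add_cos_sq (Real.pi / k)
  set p := tangential (Real.pi / k * n) z
  set c := Real.cos (Real.pi / k * j)
  set s := Real.sin (Real.pi / k * j)
  set C := Real.cos (Real.pi / k)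
  set S := Real.sin (Real.pi / k)
  have hc2 : c ^ 2 ≤ C ^ 2 := sq_le_sq' (by linarith [(abs_le.1 hcj).1]) (abs_le.1 hcj).2
  have hs2 : S ≤ |s| := by
    rw [← abs_of_pos hs]; exact sq_le_sq.1 (by linarith)
  have hpC : |p| * C < r * S := by
    have : |p| < r * (S / C) := by rw [← Real.tan_eq_sin_div_cos]; linarith
    calc |p| * C < r * (S / C) * C := by gcongr
      _ = r * S := by field_simp
  have h3 : |p| * |c| < r * |s| :=
    calc _ ≤ |p| * C := by gcongr
      _ < r * S := hpC
      _ ≤ r * |s| := by gcongr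
  have h4 : s * c * p ≤ |s| * (|p| * |c|) := by
    refine (le_abs_self _).trans_eq ?_
    rw [abs_mul, abs_mul]; ring
  have h5 : |s| * (|p| * |c|) < |s| * (r * |s|) :=
    mul_lt_mul_of_pos_left h3 (by linarith)
  have h6 : |s| * (r * |s|) = r * s ^ 2 := by rw [← sq_abs s]; ring
  nlinarith

theorem radial_periodic {k : ℕ} (hk : 0 < k) {n j : ℤ} (hj : (k : ℤ) ∣ j) (z : Plane) :
    radial (Real.pi / k * (n + 2 * j : ℤ)) z = radial (Real.pi / k * n) z := by
  obtain ⟨c, rfl⟩ := hj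
  have hk' : (k : ℝ) ≠ 0 := by exact_mod_cast hk.ne'
  have : Real.pi / k * (n + 2 * (k * c) : ℤ) = Real.pi / k * n + c * (2 * Real.pi) := by
    push_cast; field_simp
  rw [this, radial_apply, radial_apply, Real.cos_add_int_mul_two_pi, Real.sin_add_int_mul_two_pi]

theorem radial_le_of_mem_side {k : ℕ} (hk : 4 ≤ k) {n : ℤ} {r T : ℝ} (hr : 0 < r)
    (hT : T < r * Real.tan (Real.pi / k)) {z : Plane} (hz : z ∈ side (Real.pi / k * n) r T)
    (j : ℤ) : radial (Real.pi / k * (n + 2 * j : ℤ)) z ≤ r := by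
  by_cases hj : (k : ℤ) ∣ j
  · rw [radial_periodic (by omega) hj]; exact hz.1.le
  · exact (radial_lt_of_mem_side hk hr hT hz hj).le

/-- Each normal of a polygon bisects two adjacent normals of the previous one, so its coordinate is
at most q^i / cos(π/k) < q^(i+1): the polygons are strictly nested. -/
theorem radial_lt_of_layer_le {k : ℕ} (hk : 4 ≤ k) {q : ℝ} (hq0 : 0 < q)
    (hq : 1 < q * Real.cos (Real.pi / k)) {z : Plane} {i i' : ℕ} (hii : i < i')
    (h : ∀ j : ℤ, radial (Real.pi / k * (2 * j + i : ℤ)) z ≤ q ^ i) (j : ℤ) :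
    radial (Real.pi / k * (2 * j + i' : ℤ)) z < q ^ i' := by
  obtain ⟨-, hc⟩ := sin_cos_pi_div_pos hk
  have step : ∀ i : ℕ, (∀ j : ℤ, radial (Real.pi / k * (2 * j + i : ℤ)) z ≤ q ^ i) →
      ∀ j : ℤ, radial (Real.pi / k * (2 * j + (i + 1 : ℕ) : ℤ)) z < q ^ (i + 1) := by
    intro i h j
    have := radial_sub_add_radial_add (Real.pi / k * (2 * j + (i + 1 : ℕ) : ℤ)) (Real.pi / k) z
    have h1 := h j
    have h2 := h (j + 1)
    rw [show Real.pi / k * (2 * j + i : ℤ) = Real.pi / k * (2 * j + (i + 1 : ℕ) : ℤ) - Real.pi / k by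
      push_cast; ring] at h1
    rw [show Real.pi / k * (2 * (j + 1) + i : ℤ) =
      Real.pi / k * (2 * j + (i + 1 : ℕ) : ℤ) + Real.pi / k by push_cast; ring] at h2
    have h3 : q ^ i < q ^ (i + 1) * Real.cos (Real.pi / k) := by
      rw [pow_succ, mul_assoc]
      exact lt_mul_of_one_lt_right (by positivity) hq
    have h4 : Real.cos (Real.pi / k) * radial (Real.pi / k * (2 * j + (i + 1 : ℕ) : ℤ)) z <
        Real.cos (Real.pi / k) * q ^ (i + 1) := by linarith
    exact lt_of_mul_lt_mul_left h4 hc.le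
  obtain ⟨d, rfl⟩ : ∃ d, i' = i + d + 1 := ⟨i' - i - 1, by omega⟩
  clear hii
  induction d generalizing j with
  | zero => exact step i h j
  | succ d ih => exact step (i + d + 1) (fun j => (ih j).le) j

/-- The level `q ^ i` of this function is the boundary of the `i`-th polygon. -/
noncomputable def layerSup (k : ℕ) (hk : 0 < k) (i : ℕ) (z : Plane) : ℝ :=
  (Finset.range k).sup' ⟨0, Finset.mem_range.2 hk⟩
    fun j => radial (Real.pi / k * (2 * j + i : ℤ)) z

theorem continuous_layerSup (k : ℕ) (hk : 0 < k) (i : ℕ) : Continuous (layerSup k hk i) :=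
  Continuous.finset_sup'_apply _ fun _ _ => (radial _).continuous_of_finiteDimensional

theorem radial_le_layerSup {k : ℕ} (hk : 0 < k) (i : ℕ) (z : Plane) (j : ℤ) :
    radial (Real.pi / k * (2 * j + i : ℤ)) z ≤ layerSup k hk i z := by
  have hk' : (0 : ℤ) < k := by exact_mod_cast hk
  obtain ⟨m, hm⟩ := Int.eq_ofNat_of_zero_le (Int.emod_nonneg j hk'.ne')
  have hmk : m < k := by
    have := Int.emod_lt_of_pos j hk'
    omega
  have hj := Int.emod_add_mul_ediv j k
  have : (2 * j + i : ℤ) = (2 * m + i : ℤ) + 2 * (k * (j / k)) := by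
    rw [← hm]; linarith
  rw [this, radial_periodic hk (dvd_mul_right _ _)]
  exact Finset.le_sup' (fun j : ℕ => radial (Real.pi / k * (2 * j + i : ℤ)) z)
    (Finset.mem_range.2 hmk)

theorem exists_radial_eq_layerSup {k : ℕ} (hk : 0 < k) (i : ℕ) (z : Plane) :
    ∃ j < k, radial (Real.pi / k * (2 * j + i : ℤ)) z = layerSup k hk i z := by
  obtain ⟨j, hj, h⟩ := Finset.exists_mem_eq_sup' ⟨0, Finset.mem_range.2 hk⟩
    fun j : ℕ => radial (Real.pi / k * (2 * j + i : ℤ)) z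
  exact ⟨j, Finset.mem_range.1 hj, h.symm⟩

/-- A point of a polygon that is not on the shortened sides is close to a corner. -/
theorem exists_corner {k : ℕ} (hk : 4 ≤ k) {i : ℕ} {r ρ : ℝ} {z : Plane}
    (hz : layerSup k (by omega) i z = r)
    (hside : ∀ j < k, z ∉ side (Real.pi / k * (2 * j + i : ℤ)) r (r * Real.tan (Real.pi / k) - ρ)) :
    ∃ j : ℤ, dist z (polarPoint (Real.pi / k * (2 * j + i + 1 : ℤ)) (r / Real.cos (Real.pi / k)) 0) ≤ ρ := by
  obtain ⟨hs, hc⟩ := sin_cos_pi_div_pos hk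
  obtain ⟨j, hj, hjz⟩ := exists_radial_eq_layerSup (by omega : 0 < k) i z
  have hle := radial_le_layerSup (by omega : 0 < k) i z
  rw [hz] at hle hjz
  have hp : r * Real.tan (Real.pi / k) - ρ < |tangential (Real.pi / k * (2 * j + i : ℤ)) z| := by
    by_contra! h
    exact hside j hj ⟨hjz, h⟩
  have h1 := hle (j + 1)
  have h2 := hle (j - 1)
  rw [show Real.pi / k * (2 * (j + 1) + i : ℤ) =
    Real.pi / k * (2 * j + i : ℤ) + 2 * (Real.pi / k) by push_cast; ring, radial_add, hjz,
    Real.sin_two_mul, Real.cos_two_mul'] at h1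
  rw [show Real.pi / k * (2 * (j - 1) + i : ℤ) =
    Real.pi / k * (2 * j + i : ℤ) + -(2 * (Real.pi / k)) by push_cast; ring, radial_add, hjz,
    Real.cos_neg, Real.sin_neg, Real.sin_two_mul, Real.cos_two_mul'] at h2
  have hzp := polarPoint_radial_tangential (Real.pi / k * (2 * j + i : ℤ)) z
  rw [hjz] at hzp
  have hcorner := polarPoint_corner (Real.pi / k * (2 * j + i : ℤ)) r hc.ne'
  have hcorner' := polarPoint_corner (Real.pi / k * (2 * j + i : ℤ)) r (a := -(Real.pi / k))
    (by rw [Real.cos_neg]; exact hc.ne')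
  rw [Real.tan_neg, Real.cos_neg] at hcorner'
  set p := tangential (Real.pi / k * (2 * j + i : ℤ)) z
  have hsc := Real.sin_sq_add_cos_sq (Real.pi / k)
  have htan : Real.tan (Real.pi / k) * Real.cos (Real.pi / k) = Real.sin (Real.pi / k) :=
    Real.tan_mul_cos hc.ne'
  -- The two neighbouring sides confine the tangential offset to the full side; off the shortened
  -- side it is therefore within `ρ` of an end.
  have hbound : ∀ p : ℝ, (Real.cos (Real.pi / k) ^ 2 - Real.sin (Real.pi / k) ^ 2) * r +
      2 * Real.sin (Real.pi / k) * Real.cos (Real.pi / k) * p ≤ r →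
      p ≤ r * Real.tan (Real.pi / k) := by
    intro p h
    have h3 : (2 * Real.sin (Real.pi / k)) * (p * Real.cos (Real.pi / k)) ≤
        (2 * Real.sin (Real.pi / k)) * (r * Real.sin (Real.pi / k)) := by
      have : r = r * (Real.sin (Real.pi / k) ^ 2 + Real.cos (Real.pi / k) ^ 2) := by
        rw [hsc, mul_one]
      linarith
    have h4 := le_of_mul_le_mul_left h3 (by linarith)
    rw [← htan, ← mul_assoc] at h4
    exact le_of_mul_le_mul_right h4 hc
  have h3 := hbound p h1
  have h4 := hbound (-p) (by linarith)
  rcases le_total 0 p with h0 | h0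
  · refine ⟨j, ?_⟩
    rw [show Real.pi / k * (2 * j + i + 1 : ℤ) = Real.pi / k * (2 * j + i : ℤ) + Real.pi / k by
      push_cast; ring, ← hcorner, ← hzp, dist_polarPoint_same, abs_sub_comm,
      abs_of_nonneg (by linarith)]
    rw [abs_of_nonneg h0] at hp
    linarith
  · refine ⟨j - 1, ?_⟩
    rw [show Real.pi / k * (2 * (j - 1) + i + 1 : ℤ) =
      Real.pi / k * (2 * j + i : ℤ) + -(Real.pi / k) by
      push_cast; ring, ← hcorner', ← hzp, dist_polarPoint_same, abs_of_nonneg (by linarith)]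
    rw [abs_of_nonpos h0] at hp
    linarith

/-! ### The layered construction -/

theorem le_geod_of_level {P : Set Plane} {s t : Plane} {f : Plane → ℝ} (hf : Continuous f) {c : ℝ}
    (hs : f s ≤ c) (ht : c ≤ f t) {L : ℝ≥0∞}
    (h : ∀ z ∈ P, f z = c → L ≤ edist s z + geod P z t) : L ≤ geod P s t := by
  refine le_iInf fun n => le_iInf fun p => le_iInf fun hp => ?_
  obtain ⟨z, hz, hfz, hle⟩ := exists_level_le_pathLength hp hf hs ht
  exact (h z hz hfz).trans hle

/-- The sides, shortened at both ends, of the `i`-th of the nested regular `k`-gons. -/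
noncomputable def layerSide (k : ℕ) (q : ℝ) (i j : ℕ) : Set Plane :=
  side (Real.pi / k * (2 * j + i : ℤ)) (q ^ i) (q ^ i * Real.tan (Real.pi / k) - 1 / (2 * k))

/-- Induction on the number `d` of layers still to be crossed. The path from `z` must meet the next
polygon at some `w`; both points lie near corners of their polygons, and the corners are at least
2/k apart. -/
theorem ofReal_le_geod_of_layers {k : ℕ} (hk : 4 ≤ k) {q : ℝ} (hq1 : 1 ≤ q)
    (hq : 1 < q * Real.cos (Real.pi / k)) {m : ℕ} {P : Set Plane}
    (hP : ∀ i < m, ∀ j < k, Disjoint (layerSide k q i j) P) {t : Plane}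
    (ht : ∀ i < m, q ^ i ≤ layerSup k (by omega) i t) (d i : ℕ) (hid : i + d + 1 = m) {z : Plane}
    (hzP : z ∈ P) (hz : layerSup k (by omega) i z = q ^ i) :
    ENNReal.ofReal (d / k) ≤ geod P z t := by
  obtain ⟨-, hc⟩ := sin_cos_pi_div_pos hk
  have hk' : (0 : ℝ) < k := by exact_mod_cast (by omega : 0 < k)
  induction d generalizing i z with
  | zero => simp
  | succ d ih =>
    have hlt := radial_lt_of_layer_le hk (by linarith) hq (Nat.lt_succ_self i)
      (fun j => (radial_le_layerSup (by omega) i z j).trans hz.le)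
    refine le_geod_of_level (continuous_layerSup k (by omega) (i + 1)) (c := q ^ (i + 1)) ?_
      (ht (i + 1) (by omega)) fun w hwP hw => ?_
    · obtain ⟨j, -, hj⟩ := exists_radial_eq_layerSup (by omega : 0 < k) (i + 1) z
      rw [← hj]
      exact (hlt j).le
    · have hgeod := ih (i + 1) (by omega) hwP hw
      obtain ⟨j, hj⟩ := exists_corner hk hz fun j hj hmem =>
        Set.disjoint_left.1 (hP i (by omega) j hj) hmem hzP
      obtain ⟨j', hj'⟩ := exists_corner hk hw fun j hj hmem =>
        Set.disjoint_left.1 (hP (i + 1) (by omega) j hj) hmem hwP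
      have hone : ∀ i : ℕ, 1 ≤ q ^ i / Real.cos (Real.pi / k) := fun i => by
        rw [one_le_div hc]
        exact (Real.cos_le_one _).trans (one_le_pow₀ hq1)
      have hcorner := dist_polarPoint_ge (by omega : 0 < k) (n := 2 * j + i + 1)
        -- The corner angles of consecutive layers differ by an odd multiple of π/k, never by a
        -- multiple of 2π.
        (n' := 2 * j' + (i + 1 : ℕ) + 1) (fun h => by
          have := (dvd_mul_right (2 : ℤ) k).trans h
          omega) (hone i) (hone (i + 1))
      have htri := dist_triangle4 (polarPoint (Real.pi / k * (2 * j + i + 1 : ℤ))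
        (q ^ i / Real.cos (Real.pi / k)) 0) z w
        (polarPoint (Real.pi / k * (2 * j' + (i + 1 : ℕ) + 1 : ℤ))
          (q ^ (i + 1) / Real.cos (Real.pi / k)) 0)
      rw [dist_comm _ z] at htri
      have hzw : 1 / k ≤ dist z w := by
        -- Each end of a side is cut by 1/(2k), so the two displacements use up only half of 2/k.
        have : (2 / k : ℝ) = 1 / k + 2 * (1 / (2 * k)) := by field_simp; norm_num
        linarith
      rw [show ((d + 1 : ℕ) / k : ℝ) = 1 / k + d / k by push_cast; ring,
        ENNReal.ofReal_add (by positivity) (by positivity), edist_dist]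
      exact add_le_add (ENNReal.ofReal_le_ofReal hzw) hgeod

theorem exists_ratio {k : ℕ} (hk : 4 ≤ k) : ∃ q : ℝ, 1 ≤ q ∧ 1 < q * Real.cos (Real.pi / k) ∧
    ∀ i < k ^ 2, q ^ i ≤ Real.exp 10 := by
  have hk' : (4 : ℝ) ≤ k := by exact_mod_cast hk
  have hq1 : 1 ≤ 1 + 10 / (k : ℝ) ^ 2 := by
    have : 0 ≤ 10 / (k : ℝ) ^ 2 := by positivity
    linarith
  -- Since π² ≤ 10, the cosine is at least 1 − 5/k²; the factor 1 + 10/k² beats this for `k ≥ 4`,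
  -- while its k²-th power stays below e^10.
  refine ⟨1 + 10 / (k : ℝ) ^ 2, hq1, ?_, fun i hi => ?_⟩
  · have h1 := Real.one_sub_sq_div_two_le_cos (x := Real.pi / k)
    have h2 : Real.pi ^ 2 ≤ 10 := by nlinarith [Real.pi_lt_d2, Real.pi_pos]
    have h3 : (1 : ℝ) / k ^ 2 ≤ 1 / 16 := by
      gcongr; nlinarith
    have h4 : 0 < (1 : ℝ) / k ^ 2 := by positivity
    rw [div_pow] at h1
    have h5 : Real.pi ^ 2 / k ^ 2 ≤ 10 * (1 / (k : ℝ) ^ 2) := by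
      rw [mul_one_div]; gcongr
    have h6 : 10 / (k : ℝ) ^ 2 = 10 * (1 / (k : ℝ) ^ 2) := by ring
    rw [h6]
    set u := 1 / (k : ℝ) ^ 2
    nlinarith
  · calc (1 + 10 / (k : ℝ) ^ 2) ^ i ≤ (1 + 10 / (k : ℝ) ^ 2) ^ (k ^ 2) := pow_le_pow_right₀ hq1 hi.le
      _ ≤ Real.exp (10 / (k : ℝ) ^ 2) ^ (k ^ 2) := by
        gcongr
        rw [add_comm]; exact Real.add_one_le_exp _
      _ = Real.exp 10 := by
        rw [← Real.exp_nat_mul]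
        congr 1
        push_cast
        field_simp

/-- The lower bound keeps the shortened sides nonempty, the upper bound keeps their norms of order
`q ^ i`. -/
theorem tan_pi_div_bounds {k : ℕ} (hk : 4 ≤ k) :
    1 / (2 * k) ≤ Real.tan (Real.pi / k) ∧ Real.tan (Real.pi / k) ≤ 1 := by
  have hk' : (4 : ℝ) ≤ k := by exact_mod_cast hk
  obtain ⟨h1, h2⟩ := pi_div_mem_Ioc hk
  have hpi := Real.pi_pos
  constructor
  · refine le_trans ?_ (Real.le_tan h1.le (by linarith))
    rw [div_le_div_iff₀ (by positivity) (by positivity)]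
    nlinarith [Real.pi_gt_three]
  · rw [← Real.tan_pi_div_four]
    exact Real.strictMonoOn_tan.monotoneOn ⟨by linarith, by linarith⟩ ⟨by linarith, by linarith⟩ h2

section Layers

variable {k : ℕ} {q : ℝ}

theorem layerSide_width_lt (hk : 4 ≤ k) (i : ℕ) :
    q ^ i * Real.tan (Real.pi / k) - 1 / (2 * k) < q ^ i * Real.tan (Real.pi / k) := by
  have hk' : (4 : ℝ) ≤ k := by exact_mod_cast hk
  have : (0 : ℝ) < 1 / (2 * k) := by positivity
  linarith

theorem layerSide_nonempty (hk : 4 ≤ k) (hq1 : 1 ≤ q) (i j : ℕ) :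
    (layerSide k q i j).Nonempty := by
  refine side_nonempty _ _ ?_
  have h1 := (tan_pi_div_bounds hk).1
  have h2 : (0 : ℝ) ≤ 1 / (2 * k) := by positivity
  have := mul_le_mul_of_nonneg_right (one_le_pow₀ hq1 (n := i)) (h2.trans h1)
  linarith

theorem norm_le_of_mem_layerSide (hk : 4 ≤ k) (hq1 : 1 ≤ q) {i j : ℕ} {z : Plane}
    (hz : z ∈ layerSide k q i j) : ‖z‖ ≤ 4 * q ^ i := by
  have h0 : 0 ≤ q ^ i := by positivity
  have h1 := norm_le_of_mem_side hz h0
  have h2 := layerSide_width_lt (q := q) hk i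
  have h3 := mul_le_mul_of_nonneg_left (tan_pi_div_bounds hk).2 h0
  linarith

theorem disjoint_layerSide_of_lt (hk : 4 ≤ k) (hq1 : 1 ≤ q)
    (hq : 1 < q * Real.cos (Real.pi / k)) {i j i' j' : ℕ} (hi : i < i') :
    Disjoint (layerSide k q i j) (layerSide k q i' j') := by
  rw [Set.disjoint_left]
  intro z hz hz'
  refine (radial_lt_of_layer_le hk (by linarith) hq hi (fun l => ?_) j').ne hz'.1
  have := radial_le_of_mem_side hk (by positivity) (layerSide_width_lt hk i) hz (l - j)
  rwa [show (2 * j + i + 2 * (l - j) : ℤ) = 2 * l + i by ring] at this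

theorem disjoint_layerSide_same (hk : 4 ≤ k) (hq1 : 1 ≤ q) {i j j' : ℕ} (hj : j < k) (hj' : j' < k)
    (hjj : j ≠ j') : Disjoint (layerSide k q i j) (layerSide k q i j') := by
  rw [Set.disjoint_left]
  intro z hz hz'
  have := radial_lt_of_mem_side hk (by positivity) (layerSide_width_lt hk i) hz
    (j := j' - j) (fun h => hjj (by
      have := Int.eq_zero_of_abs_lt_dvd h (by rw [abs_lt]; omega)
      omega))
  rw [show (2 * j + i + 2 * (j' - j) : ℤ) = 2 * j' + i by ring] at this
  exact this.ne hz'.1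

theorem disjoint_layerSide (hk : 4 ≤ k) (hq1 : 1 ≤ q)
    (hq : 1 < q * Real.cos (Real.pi / k)) {i j i' j' : ℕ} (hj : j < k) (hj' : j' < k)
    (hne : i ≠ i' ∨ j ≠ j') : Disjoint (layerSide k q i j) (layerSide k q i' j') := by
  rcases lt_trichotomy i i' with h | rfl | h
  · exact disjoint_layerSide_of_lt hk hq1 hq h
  · exact disjoint_layerSide_same hk hq1 hj hj' (by simpa using hne)
  · exact (disjoint_layerSide_of_lt hk hq1 hq h).symm

end Layers

/-- Points on an axis, with norms in `(R, R + 1]`. -/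
noncomputable def axisPoint (R : ℝ) (l : ℕ) : Plane := EuclideanSpace.single 0 (R + 1 / (l + 1))

theorem norm_axisPoint {R : ℝ} (hR : 0 ≤ R) (l : ℕ) : ‖axisPoint R l‖ = R + 1 / (l + 1) := by
  rw [axisPoint, PiLp.norm_single, Real.norm_of_nonneg (by positivity)]

theorem axisPoint_injective (R : ℝ) : Function.Injective (axisPoint R) := by
  intro l l' h
  have := congrArg (fun z : Plane => z 0) h
  simp only [axisPoint, PiLp.single_apply, if_true, add_right_inj, one_div, inv_inj,
    add_left_inj] at this
  exact_mod_cast this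

theorem norm_axisPoint_le {R : ℝ} (hR : 0 ≤ R) (l : ℕ) : ‖axisPoint R l‖ ≤ R + 1 := by
  rw [norm_axisPoint hR]
  have : 1 / (l + 1 : ℝ) ≤ 1 := (div_le_one (by positivity)).2 (by linarith [l.cast_nonneg (α := ℝ)])
  linarith

theorem lt_norm_axisPoint {R : ℝ} (hR : 0 ≤ R) (l : ℕ) : R < ‖axisPoint R l‖ := by
  rw [norm_axisPoint hR]
  have : 0 < 1 / (l + 1 : ℝ) := by positivity
  linarith

/-- Settles the small values of `h`: any domain with two distinct points will do, here with holes
around points of an axis. -/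
theorem one_le_maxDistortion (h : ℕ) : 1 ≤ maxDistortion h := by
  have ht : ‖(EuclideanSpace.single 0 2 : Plane)‖ = 2 := by simp
  obtain ⟨P, hP, h0, htP, -, hdiam⟩ := exists_convexDomain (h := h) (fun i => {axisPoint 0 i})
    (fun i => isCompact_singleton) (fun i => convex_singleton _) (fun i => Set.singleton_nonempty _)
    (fun i j hij => Set.disjoint_singleton.2 fun h => hij (Fin.ext (axisPoint_injective 0 h)))
    (R := 2) (by norm_num) (fun i => by
      rw [Set.singleton_subset_iff, mem_closedBall_zero_iff]
      linarith [norm_axisPoint_le le_rfl i]) (t := EuclideanSpace.single 0 2) ht.le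
    (fun i hi => by
      have := lt_norm_axisPoint le_rfl (i : ℕ)
      rw [← Set.mem_singleton_iff.1 hi] at this
      simp at this) (fun i hi => by
      have := norm_axisPoint_le le_rfl (i : ℕ)
      rw [← Set.mem_singleton_iff.1 hi, ht] at this
      norm_num at this)
  refine le_iSup₂_of_le P hP (one_le_distortion h0 htP (fun h => ?_)
    (ne_top_of_le_ne_top ENNReal.ofReal_ne_top hdiam))
  rw [← h, norm_zero] at ht
  norm_num at ht

/-- The `l`-th hole before thickening: a side of the layers, or else a point outside. -/
noncomputable def holeCore (k : ℕ) (q R : ℝ) (l : ℕ) : Set Plane :=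
  if l < k ^ 3 then layerSide k q (l / k) (l % k) else {axisPoint R l}

/-- The k² layers use k³ holes, and the surplus ones are put around points beyond all layers. From
the centre to a point still further out, k² − 1 gaps of 1/k each have to be crossed. -/
theorem le_maxDistortion_of_cube_le {h k : ℕ} (hk : 4 ≤ k) (hkh : k ^ 3 ≤ h) :
    ENNReal.ofReal (((k ^ 2 - 1 : ℕ) / k : ℝ) / (2 * (4 * Real.exp 10 + 3))) ≤ maxDistortion h := by
  obtain ⟨q, hq1, hq, hqe⟩ := exists_ratio hk
  have hk0 : 0 < k := by omega
  set R := 4 * Real.exp 10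
  have hR : 0 ≤ R := by positivity
  have hdiv : ∀ l < k ^ 3, l / k < k ^ 2 := fun l hl =>
    Nat.div_lt_of_lt_mul (by rwa [← pow_succ'])
  have hnorm : ∀ l < k ^ 3, ∀ z ∈ layerSide k q (l / k) (l % k), ‖z‖ ≤ R := fun l hl z hz =>
    (norm_le_of_mem_layerSide hk hq1 hz).trans
      (mul_le_mul_of_nonneg_left (hqe _ (hdiv l hl)) (by norm_num))
  have ht : ‖(EuclideanSpace.single 0 (R + 2) : Plane)‖ = R + 2 := by
    rw [PiLp.norm_single, Real.norm_of_nonneg (by linarith)]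
  have hS : ∀ l, ∀ z ∈ holeCore k q R l, ‖z‖ ≤ R + 1 := by
    intro l z hz
    rw [holeCore] at hz
    split_ifs at hz with hl
    · linarith [hnorm l hl z hz]
    · rw [Set.mem_singleton_iff.1 hz]
      exact norm_axisPoint_le hR l
  obtain ⟨P, hP, h0, htP, hd, hdiam⟩ := exists_convexDomain (h := h) (fun i => holeCore k q R i)
    (fun i => by
      rw [holeCore]; split_ifs
      exacts [isCompact_side _ _ _, isCompact_singleton])
    (fun i => by
      rw [holeCore]; split_ifs
      exacts [convex_side _ _ _, convex_singleton _])
    (fun i => by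
      rw [holeCore]; split_ifs
      exacts [layerSide_nonempty hk hq1 _ _, Set.singleton_nonempty _])
    (fun i j hij => by
      have hij' : (i : ℕ) ≠ j := fun h => hij (Fin.ext h)
      rw [holeCore, holeCore]
      split_ifs with hi hj hj
      · refine disjoint_layerSide hk hq1 hq (Nat.mod_lt _ hk0) (Nat.mod_lt _ hk0) ?_
        by_contra! h
        exact hij' (by rw [← Nat.div_add_mod i k, ← Nat.div_add_mod j k, h.1, h.2])
      · rw [Set.disjoint_singleton_right]
        intro h
        linarith [hnorm i hi _ h, lt_norm_axisPoint hR j]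
      · rw [Set.disjoint_singleton_left]
        intro h
        linarith [hnorm j hj _ h, lt_norm_axisPoint hR i]
      · exact Set.disjoint_singleton.2 fun h => hij' (axisPoint_injective R h))
    (R := R + 2) (by linarith) (fun i z hz => by
      rw [mem_closedBall_zero_iff]
      linarith [hS i z hz]) (t := EuclideanSpace.single 0 (R + 2)) ht.le
    (fun i hi => by
      rw [holeCore] at hi
      split_ifs at hi with hl
      · have := hi.1
        rw [map_zero] at this
        exact (pow_pos (by linarith : 0 < q) _).ne this
      · have := lt_norm_axisPoint hR (i : ℕ)
        rw [← Set.mem_singleton_iff.1 hi, norm_zero] at this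
        linarith) (fun i hi => by
      linarith [hS i _ hi])
  rw [show R + 2 + 1 = R + 3 by ring] at hdiam
  refine le_trans ?_ (le_iSup₂_of_le P hP le_rfl)
  refine ofReal_div_le_distortion h0 htP (by linarith) ?_ hdiam
  have hk2 : 0 < k ^ 2 := by positivity
  have htlayer : ∀ i < k ^ 2, q ^ i ≤ layerSup k hk0 i (EuclideanSpace.single 0 (R + 2)) := by
    intro i hi
    -- This index picks the normal at angle 0 or π/k, according to the parity of `i`; its cosine is
    -- at least 1/2, enough since `R = 4 * exp 10`.
    refine le_trans ?_ (radial_le_layerSup hk0 i _ (-(i / 2 : ℕ)))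
    have hcos : 1 / 2 ≤ Real.cos (Real.pi / k * (2 * (-(i / 2 : ℕ)) + i : ℤ)) := by
      obtain ⟨h1, h2⟩ := pi_div_mem_Ioc hk
      have hpi := Real.pi_pos
      have hmod : (2 * (-(i / 2 : ℕ)) + i : ℤ) = (i % 2 : ℕ) := by omega
      rw [hmod, ← Real.cos_pi_div_three]
      have h3 : ((i % 2 : ℕ) : ℝ) ≤ 1 := by exact_mod_cast (by omega : i % 2 ≤ 1)
      refine Real.cos_le_cos_of_nonneg_of_le_pi (by positivity) (by linarith) ?_
      rw [Int.cast_natCast]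
      calc _ ≤ Real.pi / k * 1 := by gcongr
        _ ≤ _ := by linarith
    have h1 := hqe i hi
    rw [radial_apply]
    simp only [PiLp.single_apply, if_true, one_ne_zero, if_false, mul_zero, add_zero]
    have h2 := mul_le_mul_of_nonneg_right hcos (by linarith : 0 ≤ R + 2)
    have h3 := Real.exp_pos 10
    linarith
  refine le_geod_of_level (continuous_layerSup k hk0 0) (c := q ^ 0) ?_ (htlayer 0 hk2)
    fun z hz hzl => ?_
  · obtain ⟨j, -, hj⟩ := exists_radial_eq_layerSup hk0 0 0
    rw [← hj, map_zero]
    positivity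
  · refine le_add_left (ofReal_le_geod_of_layers hk hq1 hq (m := k ^ 2) (fun i hi j hj => ?_)
      htlayer (k ^ 2 - 1) 0 (by omega) hz hzl)
    have hlt : k * i + j < k ^ 3 := by
      calc k * i + j < k * i + k := by omega
        _ = k * (i + 1) := by ring
        _ ≤ k * k ^ 2 := Nat.mul_le_mul_left _ hi
        _ = k ^ 3 := by ring
    have := hd ⟨k * i + j, hlt.trans_le hkh⟩
    simp only [holeCore, hlt, if_true] at this
    rwa [Nat.mul_add_div hk0, Nat.div_eq_of_lt hj, add_zero, Nat.mul_add_mod,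
      Nat.mod_eq_of_lt hj] at this

/-! ### The two bounds combined -/

theorem le_maxDistortion (h : ℕ) :
    ENNReal.ofReal (1 / (8 * (4 * Real.exp 10 + 3)) * (h : ℝ) ^ (1 / 3 : ℝ)) ≤ maxDistortion h := by
  set x := (h : ℝ) ^ (1 / 3 : ℝ)
  have hx : 0 ≤ x := by positivity
  have hx3 : x ^ 3 = h := by
    rw [← Real.rpow_natCast, ← Real.rpow_mul (by positivity)]
    norm_num
  have hE := Real.exp_pos 10
  set k := ⌊x⌋₊
  have hkx : (k : ℝ) ≤ x := Nat.floor_le hx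
  have hxk : x < k + 1 := Nat.lt_floor_add_one x
  rw [one_div_mul_eq_div]
  rcases lt_or_ge k 4 with hk | hk
  · refine le_trans ?_ (one_le_maxDistortion h)
    rw [← ENNReal.ofReal_one]
    refine ENNReal.ofReal_le_ofReal ((div_le_one (by positivity)).2 ?_)
    have : (k : ℝ) + 1 ≤ 4 := by exact_mod_cast hk
    linarith
  · have hkh : k ^ 3 ≤ h := by
      have : (k : ℝ) ^ 3 ≤ x ^ 3 := by gcongr
      rw [hx3] at this
      exact_mod_cast this
    refine le_trans (ENNReal.ofReal_le_ofReal ?_) (le_maxDistortion_of_cube_le hk hkh)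
    have hk' : (4 : ℝ) ≤ k := by exact_mod_cast hk
    -- With `k ≤ x < k + 1` and `k ≥ 4` one has k − 1/k ≥ x/4; this 4 and the 2 from the diameter
    -- make the 8 in the constant.
    have h1 : x / 4 ≤ (k ^ 2 - 1 : ℕ) / k := by
      rw [le_div_iff₀ (by linarith), Nat.cast_sub (Nat.one_le_pow _ _ (by omega))]
      push_cast
      nlinarith
    calc x / (8 * (4 * Real.exp 10 + 3)) = x / 4 / (2 * (4 * Real.exp 10 + 3)) := by
          field_simp; ring
      _ ≤ _ := by gcongr

theorem theorem1 :
    ∃ c C : ℝ, 0 < c ∧ 0 < C ∧ ∀ h : ℕ, 1 ≤ h →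
      ENNReal.ofReal (c * (h : ℝ) ^ (1 / 3 : ℝ)) ≤ maxDistortion h ∧
      maxDistortion h ≤ ENNReal.ofReal (C * (h : ℝ) ^ (1 / 2 : ℝ)) := by
  refine ⟨1 / (8 * (4 * Real.exp 10 + 3)), 52, by positivity, by norm_num, fun h hh =>
    ⟨le_maxDistortion h, iSup₂_le fun P hP => ?_⟩⟩
  rw [← Real.sqrt_eq_rpow]
  exact distortion_le hh hP
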